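/- **Setting.** Let $\mathcal S,\mathcal A,\mathcal O,\mathcal G,\Omega$ be measurable spaces (physical states, low-level actions, observations, subgoals, tasks) and $\mathcal Z$ a finite set of latent variables. Each $z\in\mathcal Z$ specifies low-level transition kernels $\mathbb T_{h,\bar h}(\cdot\mid s,a)$ and an Actor policy $\mu_{\bar h}(\cdot\mid s,g)$; running these for $H_a$ low-level steps from state $s$ with subgoal $g$ gives the high-level transition kernel $\mathbb P_{z,h}(s'\mid s,g)$. The horizon is $H\ge 1$, the initial state has law $\rho$, the ground-truth translator is a kernel $\mathbb O(o\mid s)$, and rewards $r_h(o,\omega)\in[0,1]$ are measurable in $o$. Write $\tau_h=(o_1,g_1,\dots,g_{h-1},o_h)$. A policy is a family $\pi_h(\cdot\mid\tau_h,\omega)$ of distributions on $\mathcal G$; $\mathbb P_z^\pi$ is the resulting law, $\mathcal J_z(\pi,\omega)=\mathbb E_z^\pi[\sum_{h=1}^H r_h(o_h,\omega)]$, and for each $z$ a policy $\pi_z^*$ maximizing $\mathcal J_z(\cdot,\omega)$ for every $\omega$ is given. **Pretraining distribution $\mathbb P_{\mathcal D}$.** Draw $z\sim\mathcal P_{\mathcal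 Z}$; then, in each of $T_{\rm p}$ episodes, independently given $z$, draw $\omega^t\sim\mathcal P_\Omega$ and a trajectory under $z$, $\mathbb O$ and a behavior policy $\pi^b_h(\cdot\mid\tau_h,\omega)$, and draw labels $g_h^{t,*}\sim\pi^*_{z,h}(\cdot\mid\tau_h^t,\omega^t)$. The prompt is $\mathtt{pt}_h^t=\mathcal H_t\cup\{\omega^t,\tau_h^t\}$ with $\mathcal H_t=\{(\omega^i,\tau_H^i)\}_{i<t}$. The system is *perfectly pretrained* if its Reporter translates with $\mathbb O$ and, for all $t\le T_{\rm p}$ and $h\le H$, $\mathtt{LLM}(\cdot\mid\mathtt{pt}_h^t)$ is a version of the conditional law of $g_h^{t,*}$ given $\mathtt{pt}_h^t$ under $\mathbb P_{\mathcal D}$. **Planner ($\epsilon$-greedy).** In episode $t=1,\dots,T$, given the task $\omega^t$: with probability $\epsilon$, independently of the past, choose all subgoals of the episode from an exploration policy $\pi_{h,\mathtt{exp}}(\cdot\mid\tau_h^t)$; otherwise choose all of them from $\mathtt{LLM}(\cdot\mid\mathtt{pt}_h^t)$. Then append $(\omega^t,\tau_H^t)$ to the context. Let $\pi^t$ be the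 resulting (random, context-dependent) policy of episode $t$ and $$\mathrm{Reg}_z(T)=\sum_{t=1}^T\mathbb E_{\mathcal H_t}\big[\mathcal J_z(\pi_z^*,\omega^t)-\mathcal J_z(\pi^t,\omega^t)\big],$$ the expectation being over the context generated by the planner in environment $z$. **Theorem.** There is an absolute constant $K>0$ such that the following holds. Assume that 1. the system is perfectly pretrained; 2. $\mathcal P_{\mathcal Z}(z')\le c_{\mathcal Z}\,\mathcal P_{\mathcal Z}(z)$ for all $z,z'\in\mathcal Z$, where $c_{\mathcal Z}>0$; 3. $\pi_{\mathtt{exp}}$ is $\eta$-distinguishable for some $\eta>0$: $D_{\rm H}^2\big(\mathbb P_z^{\pi_{\mathtt{exp}}}(\tau_H),\mathbb P_{z'}^{\pi_{\mathtt{exp}}}(\tau_H)\big)\ge\eta$ for all $z\ne z'$, where $D_{\rm H}^2(P,Q)=\frac12\int(\sqrt{dP}-\sqrt{dQ})^2$; 4. $1\le T\le T_{\rm p}$, and the planner explores with probability $\epsilon=\min\{1,(H\log(c_{\mathcal Z}|\mathcal Z|\sqrt T)/(T\eta))^{1/2}\}$. Then for every $z\in\mathcal Z$ and every task sequence $\{\omega^t\}_{t\le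 T}$ such that the LLM is only prompted within the support of its pretraining distribution (for all $t\le T$, $h\le H$, the law of $\mathtt{pt}_h^t$ during the planner's deployment in $z$ is absolutely continuous with respect to its law under $\mathbb P_{\mathcal D}$), $$\mathrm{Reg}_z(T)\;\le\;K\,H^{3/2}\sqrt{\frac T\eta\,\log\big(c_{\mathcal Z}|\mathcal Z|\sqrt T\big)}\;(1+\log T).$$ -/

import Mathlib

open MeasureTheory ProbabilityTheory
open scoped ENNReal

noncomputable section

namespace PAR

universe uS uA uO uG uW uZ uC uD

/-! Steps and episodes are indexed from `0`: the step `h` of the text is the index `k = h - 1`,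
and the episode `t` of the text is the index `t - 1`. -/

section Histories

variable (Ω : Type uW) (O : Type uO) (G : Type uG)

/-- `Past O G k = (O × G)^k`, the completed pairs (observation, subgoal) of `k` steps. -/
def Past : ℕ → Type (max uO uG)
  | 0 => PUnit
  | k + 1 => (Past k × O) × G

/-- The product σ-algebra on `(O × G)^k`. -/
instance instMeasurableSpacePast [MeasurableSpace O] [MeasurableSpace G] :
    ∀ k, MeasurableSpace (Past O G k)
  | 0 => inferInstanceAs (MeasurableSpace PUnit)
  | k + 1 =>
    letI := instMeasurableSpacePast k
    inferInstanceAs (MeasurableSpace ((Past O G k × O) × G))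

/-- `Hist O G k = (O × G)^k × O`, the trajectories `(o_1, g_1, …, o_k, g_k, o_{k+1})`. -/
abbrev Hist (k : ℕ) : Type (max uO uG) := Past O G k × O

/-- Contexts of `t` completed episodes of horizon `H`: sequences of `t` pairs consisting of a task
and a full trajectory `(o_1, g_1, …, g_{H-1}, o_H)`. -/
def Ctx (H : ℕ) : ℕ → Type (max uW uO uG)
  | 0 => PUnit
  | t + 1 => (Ctx H t × Ω) × Hist O G (H - 1)

/-- The product σ-algebra on contexts. -/
instance instMeasurableSpaceCtx [MeasurableSpace Ω] [MeasurableSpace O] [MeasurableSpace G]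
    (H : ℕ) : ∀ t, MeasurableSpace (Ctx Ω O G H t)
  | 0 => inferInstanceAs (MeasurableSpace PUnit)
  | t + 1 =>
    letI := instMeasurableSpaceCtx H t
    inferInstanceAs (MeasurableSpace ((Ctx Ω O G H t × Ω) × Hist O G (H - 1)))

/-- Prompts: a context of `t` completed episodes, the current task, and the current trajectory
`(o_1, g_1, …, o_{k+1})`. By definition `Ctx Ω O G H (t + 1) = Prompt Ω O G H t (H - 1)`. -/
abbrev Prompt (H t k : ℕ) : Type (max uW uO uG) := (Ctx Ω O G H t × Ω) × Hist O G k

end Histories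

/-- A randomized, trajectory-dependent subgoal policy that may also read an input in `C`.
For `C = Ω` these are the policies `π_h : (O × G)^{h-1} × O × Ω → Δ(G)`. -/
structure Policy (C : Type uC) (O : Type uO) (G : Type uG)
    [MeasurableSpace C] [MeasurableSpace O] [MeasurableSpace G] where
  step : ∀ k, Kernel (C × Hist O G k) G
  markov : ∀ k, IsMarkovKernel (step k)

attribute [instance] Policy.markov

/-- Let the policy read its input through a measurable map. -/
def Policy.comap {C : Type uC} {D : Type uD} {O : Type uO} {G : Type uG}
    [MeasurableSpace C] [MeasurableSpace D] [MeasurableSpace O] [MeasurableSpace G]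
    (π : Policy C O G) (f : D → C) (hf : Measurable f) : Policy D O G where
  step k := (π.step k).comap (fun p : D × Hist O G k => (f p.1, p.2)) (by fun_prop)
  markov _ := inferInstance

/-- The latent variable `z = (𝕋, μ)`: low-level transition kernels `𝕋_{h,h̄}` and the Actor's
subgoal-conditioned policy `μ_{h̄}`. -/
structure LowLevel (S : Type uS) (A : Type uA) (G : Type uG)
    [MeasurableSpace S] [MeasurableSpace A] [MeasurableSpace G] where
  trans : ℕ → ℕ → Kernel (S × A) S
  trans_markov : ∀ h n, IsMarkovKernel (trans h n)
  actor : ℕ → Kernel (S × G) A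
  actor_markov : ∀ n, IsMarkovKernel (actor n)

attribute [instance] LowLevel.trans_markov LowLevel.actor_markov

namespace LowLevel

variable {S : Type uS} {A : Type uA} {G : Type uG}
  [MeasurableSpace S] [MeasurableSpace A] [MeasurableSpace G]

/-- The law of the physical state after `n` low-level steps inside the high-level step `h`, as a
function of the initial state and of the subgoal. -/
def run (ℓ : LowLevel S A G) (h : ℕ) : ℕ → Kernel (S × G) S
  | 0 => Kernel.deterministic Prod.fst measurable_fst
  | n + 1 =>
    (ℓ.trans h n) ∘ₖ
      ((run ℓ h n) ⊗ₖ
        ((ℓ.actor n).comap (fun p : (S × G) × S => (p.2, p.1.2)) (by fun_prop)))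

instance (ℓ : LowLevel S A G) (h : ℕ) : ∀ n, IsMarkovKernel (ℓ.run h n)
  | 0 => inferInstanceAs (IsMarkovKernel (Kernel.deterministic Prod.fst measurable_fst))
  | n + 1 => by
    have : IsMarkovKernel (ℓ.run h n) := instIsMarkovKernelProdRun ℓ h n
    unfold run
    infer_instance

end LowLevel

/-- The hierarchical decision problem, together with its family of latent variables indexed by
`Z`. `emission` is the ground-truth translation distribution `𝕆`. -/
structure HMDP (S : Type uS) (A : Type uA) (O : Type uO) (G : Type uG) (Ω : Type uW)
    (Z : Type uZ) [MeasurableSpace S] [MeasurableSpace A] [MeasurableSpace O]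
    [MeasurableSpace G] [MeasurableSpace Ω] where
  /-- high-level horizon -/
  H : ℕ
  H_pos : 0 < H
  /-- low-level horizon -/
  Ha : ℕ
  latent : Z → LowLevel S A G
  /-- initial state distribution -/
  init : Measure S
  init_prob : IsProbabilityMeasure init
  emission : Kernel S O
  emission_markov : IsMarkovKernel emission
  reward : ℕ → O → Ω → ℝ
  reward_measurable : ∀ k w, Measurable fun o => reward k o w
  reward_mem : ∀ k o w, reward k o w ∈ Set.Icc (0 : ℝ) 1

attribute [instance] HMDP.init_prob HMDP.emission_markov

section

variable {S : Type uS} {A : Type uA} {O : Type uO} {G : Type uG} {Ω : Type uW} {Z : Type uZ}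
  [MeasurableSpace S] [MeasurableSpace A] [MeasurableSpace O] [MeasurableSpace G]
  [MeasurableSpace Ω]

namespace HMDP

variable (M : HMDP S A O G Ω Z)

/-- The high-level transition kernel `ℙ_{z,h}(· | s, g)`. -/
def highTrans (z : Z) (h : ℕ) : Kernel (S × G) S := (M.latent z).run h M.Ha

instance (z : Z) (h : ℕ) : IsMarkovKernel (M.highTrans z h) := by
  unfold highTrans; infer_instance

/-- Law of the trajectory `(o_1, g_1, …, o_{k+1})` and of the current state `s_{k+1}` under the
latent variable `z`, the translator `E` and the policy `π`, as a function of the policy's input. -/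
def trajState {C : Type uC} [MeasurableSpace C] (E : Kernel S O) (z : Z) (π : Policy C O G) :
    ∀ k, Kernel C (Hist O G k × S)
  | 0 => Kernel.const C
      ((M.init ⊗ₘ E).map (fun p : S × O => (((PUnit.unit, p.2), p.1) : Hist O G 0 × S)))
  | k + 1 =>
    ((((trajState E z π k
      ⊗ₖ (π.step k).comap (fun p : C × (Hist O G k × S) => (p.1, p.2.1)) (by fun_prop))
      ⊗ₖ (M.highTrans z k).comap
        (fun p : C × ((Hist O G k × S) × G) => (p.2.1.2, p.2.2)) (by fun_prop))
      ⊗ₖ E.comap (fun p : C × (((Hist O G k × S) × G) × S) => p.2.2) (by fun_prop))).map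
      (fun q : (((Hist O G k × S) × G) × S) × O =>
        ((((q.1.1.1.1, q.1.1.2), q.2), q.1.2) : Hist O G (k + 1) × S))

/-- `ℙ_z^π(τ)`: the law of the trajectory `τ = (o_1, g_1, …, o_{k+1})`. -/
def traj {C : Type uC} [MeasurableSpace C] (E : Kernel S O) (z : Z) (π : Policy C O G) (k : ℕ) :
    Kernel C (Hist O G k) :=
  (M.trajState E z π k).map Prod.fst

/-- Sum of the rewards of the completed steps. -/
def pastReward (w : Ω) : ∀ k, Past O G k → ℝ
  | 0, _ => 0
  | k + 1, p => pastReward w k p.1.1 + M.reward k p.1.2 w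

/-- Total reward `∑_h r_h(o_h, ω)` of a full trajectory. -/
def totalReward (w : Ω) (τ : Hist O G (M.H - 1)) : ℝ :=
  M.pastReward w (M.H - 1) τ.1 + M.reward (M.H - 1) τ.2 w

/-- Expected total reward when the full trajectory has law `P`. -/
def expectedReturn (w : Ω) (P : Measure (Hist O G (M.H - 1))) : ℝ :=
  ∫ τ, M.totalReward w τ ∂P

/-- The value function `𝒥_z(π, ω)`, with respect to the ground-truth translator. -/
def value (z : Z) (π : Policy Ω O G) (w : Ω) : ℝ :=
  M.expectedReturn w (M.traj M.emission z π (M.H - 1) w)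

/-- `π` maximizes `𝒥_z(·, ω)` over all policies, for every task `ω`. -/
def IsOptimal (z : Z) (π : Policy Ω O G) : Prop :=
  ∀ (w : Ω) (π' : Policy Ω O G), M.value z π' w ≤ M.value z π w

/-- The law of the context `H_{t+1}` of the first `t` episodes, when in each episode `i` the task
is drawn from `task i` and then the trajectory from `episode i`, given the context so far and the
task. -/
def contextLaw (task : ℕ → Measure Ω)
    (episode : ∀ i k, Kernel (Ctx Ω O G M.H i × Ω) (Hist O G k)) :
    ∀ t, Measure (Ctx Ω O G M.H t)
  | 0 => Measure.dirac PUnit.unit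
  | t + 1 => ((contextLaw task episode t).prod (task t)) ⊗ₘ episode t (M.H - 1)

/-- The law of the prompt `pt = H_t ∪ {ω, τ}` in such a sequence of episodes. -/
def promptLaw (task : ℕ → Measure Ω)
    (episode : ∀ i k, Kernel (Ctx Ω O G M.H i × Ω) (Hist O G k)) (t k : ℕ) :
    Measure (Prompt Ω O G M.H t k) :=
  ((M.contextLaw task episode t).prod (task t)) ⊗ₘ episode t k

end HMDP

/-- The pretraining distribution `ℙ_𝒟`: the prior of the latent variable, the task distribution,
the behavior policy that generates the context, the expert (optimal) policies that generate the
labels, and the number `Tp` of episodes in a sample. -/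
structure Pretraining (M : HMDP S A O G Ω Z) where
  prior : PMF Z
  taskLaw : Measure Ω
  taskLaw_prob : IsProbabilityMeasure taskLaw
  behavior : Policy Ω O G
  expert : Z → Policy Ω O G
  expert_optimal : ∀ z, M.IsOptimal z (expert z)
  Tp : ℕ

attribute [instance] Pretraining.taskLaw_prob

namespace Pretraining

variable {M : HMDP S A O G Ω Z} (D : Pretraining M)

/-- Law of the prompt `pt` under `ℙ_𝒟(· | z)`. -/
def promptLawGiven (z : Z) (t k : ℕ) : Measure (Prompt Ω O G M.H t k) :=
  M.promptLaw (fun _ => D.taskLaw)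
    (fun _ k => M.traj M.emission z (D.behavior.comap Prod.snd measurable_snd) k) t k

/-- Law of the prompt `pt` under `ℙ_𝒟`, the latent variable being integrated out. -/
def promptLaw [Fintype Z] (t k : ℕ) : Measure (Prompt Ω O G M.H t k) :=
  ∑ z, D.prior z • D.promptLawGiven z t k

/-- Joint law under `ℙ_𝒟` of the prompt `pt` and of the label `g^*`, which given `z` and `pt` is
drawn from the optimal policy for `z`; the latent variable is integrated out. -/
def promptLabelLaw [Fintype Z] (t k : ℕ) : Measure (Prompt Ω O G M.H t k × G) :=
  ∑ z, D.prior z •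
    (D.promptLawGiven z t k ⊗ₘ ((D.expert z).comap Prod.snd measurable_snd).step k)

end Pretraining

/-- A pretrained system: the Reporter's translator, and the LLM as a map from prompts to
distributions of the next subgoal. -/
structure System (M : HMDP S A O G Ω Z) where
  reporter : Kernel S O
  reporter_markov : IsMarkovKernel reporter
  llm : ∀ t, Policy (Ctx Ω O G M.H t × Ω) O G

attribute [instance] System.reporter_markov

namespace System

variable {M : HMDP S A O G Ω Z} (P : System M)

/-- The system is perfectly pretrained: the Reporter translates with the ground-truth
distribution, and on all prompts within the pretraining length the LLM's next subgoal has the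
conditional distribution of the label given the prompt under `ℙ_𝒟`. -/
structure PerfectlyPretrained [Fintype Z] (D : Pretraining M) : Prop where
  reporter_eq : ∀ s, P.reporter s = M.emission s
  llm_eq : ∀ t < D.Tp, ∀ k < M.H,
    D.promptLabelLaw t k = D.promptLaw t k ⊗ₘ (P.llm t).step k

/-- The law of the planner's trajectory in the episode `t`, given the context and the task: with
probability `ε` the exploration policy is followed during the whole episode, and otherwise
all subgoals are the LLM's. (`ε` is meant to lie in `[0, 1]`.) -/
def planner (E : Kernel S O) (z : Z) (explore : Policy PUnit.{1} O G) (ε : ℝ) (t k : ℕ) :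
    Kernel (Ctx Ω O G M.H t × Ω) (Hist O G k) where
  toFun c :=
    ENNReal.ofReal ε • M.traj E z explore k PUnit.unit
      + ENNReal.ofReal (1 - ε) • M.traj E z (P.llm t) k c
  measurable' := by
    refine Measure.measurable_of_measurable_coe _ fun s hs => ?_
    simp only [Measure.coe_add, Measure.coe_smul, Pi.add_apply, Pi.smul_apply, smul_eq_mul]
    exact measurable_const.add (measurable_const.mul (Kernel.measurable_coe _ hs))

/-- Law of the context `H_{t+1}` when the planner is deployed in the environment `z` on the task
sequence `w`. -/
def deployContextLaw (z : Z) (explore : Policy PUnit.{1} O G) (ε : ℝ) (w : ℕ → Ω) (t : ℕ) :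
    Measure (Ctx Ω O G M.H t) :=
  M.contextLaw (fun i => Measure.dirac (w i)) (P.planner P.reporter z explore ε) t

/-- Law of the prompt when the planner is deployed in the environment `z` on the task
sequence `w`. -/
def deployPromptLaw (z : Z) (explore : Policy PUnit.{1} O G) (ε : ℝ) (w : ℕ → Ω) (t k : ℕ) :
    Measure (Prompt Ω O G M.H t k) :=
  M.promptLaw (fun i => Measure.dirac (w i)) (P.planner P.reporter z explore ε) t k

/-- The regret of `T` episodes, `∑_t 𝔼_{H_t}[𝒥_z(π_z^*, ω^t) - 𝒥_z(π^t, ω^t)]`. -/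
def regret (z : Z) (best : Policy Ω O G) (explore : Policy PUnit.{1} O G) (ε : ℝ) (w : ℕ → Ω)
    (T : ℕ) : ℝ :=
  ∑ t ∈ Finset.range T,
    ∫ c, (M.value z best (w t)
      - M.expectedReturn (w t) (P.planner M.emission z explore ε t (M.H - 1) (c, w t)))
      ∂(P.deployContextLaw z explore ε w t)

end System

/-- Squared Hellinger distance `½ ∫ (√p - √q)²`, with densities taken with respect to `μ + ν`. -/
def hellingerSq {X : Type uC} [MeasurableSpace X] (μ ν : Measure X) : ℝ :=
  (1 / 2) * ∫ x, (√(μ.rnDeriv (μ + ν) x).toReal - √(ν.rnDeriv (μ + ν) x).toReal) ^ 2 ∂(μ + ν)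

/-- The exploration policy separates any two latent variables by squared Hellinger distance at
least `η` between the laws of the full trajectory. -/
def Distinguishable (M : HMDP S A O G Ω Z) (explore : Policy PUnit.{1} O G) (η : ℝ) : Prop :=
  ∀ z z' : Z, z ≠ z' →
    η ≤ hellingerSq (M.traj M.emission z explore (M.H - 1) PUnit.unit)
      (M.traj M.emission z' explore (M.H - 1) PUnit.unit)

/-- Prior coverage `sup_{z,z'} 𝒫(z') / 𝒫(z) ≤ c`; in particular every `z` has positive mass. -/
def PriorRatioBounded {Z : Type uZ} (prior : PMF Z) (c : ℝ) : Prop :=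
  ∀ z z' : Z, (prior z').toReal ≤ c * (prior z).toReal

/-- The exploration probability `(H log(c |Z| √T) / (T η))^{1/2}`, capped at `1`. -/
def exploreProb (H T card : ℕ) (c η : ℝ) : ℝ :=
  min 1 √((H : ℝ) * Real.log (c * card * √(T : ℝ)) / (T * η))

end

end PAR

end

/-! A perfectly pretrained LLM is a Bayes mixture: given the prompt it plays the expert of each
latent variable with its posterior weight (`promptLabelLaw_eq`). An episode played by the LLM
therefore departs from the expert of the true `z` only through the posterior mass of the wrong `z'`.
Keeping the part that the two trajectory laws share (`exists_common_part`), the regret of an episode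
is at most `ε H`, for exploration, plus `H` times the wrong mass summed over the steps
(`episode_regret_le`).

The wrong mass is controlled through square roots. The posterior of `z'` is at most `1` and at most
`c Λ`, with `Λ` the likelihood ratio of `z'` against `z`, hence at most `√(c Λ)`
(`posterior_le_sqrt`). Whoever chooses the subgoals, the policy's factors cancel in `Λ`
(`exists_joint_eq_withDensity`, `withDensity_lik_le`), so the ratio defined with the behavior policy
also serves for the planner. Under `z` the mean of `√Λ` never increases (`lintegral_sqrt_lik_le`),
and an exploring episode multiplies it by at most `1 - η`, the bound on the Hellinger affinity
(`lintegral_sqrt_lik_explore_le`). After `t` episodes it is at most `(1 - ε η) ^ t`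
(`ctx_invariants`).

Summing over the wrong latent variables, with `a = (|Z| - 1) √c`, the regret is at most `ε H T + H²
∑ min 1 (a (1 - ε η) ^ t)`, and the truncated series is at most `(log a + 2) / (ε η)`
(`sum_min_one_le`). The prescribed `ε` makes both terms of order `H T ε`.

The σ-algebras are arbitrary, so kernels with equal composition products need not agree almost
everywhere. The argument is carried by inequalities between measures. The laws under `z` and `z'`
may be partly singular; singular parts are dropped, since only upper bounds on posteriors and
affinities are needed. -/

namespace MeasureTheory.Measure

/-! ### Densities and composition products -/

variable {X Y G : Type*} [MeasurableSpace X] [MeasurableSpace Y] [MeasurableSpace G]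

lemma withDensity_compProd (μ : Measure X) [SFinite μ] (κ : Kernel X G) [IsSFiniteKernel κ]
    {f : X → ℝ≥0∞} (hf : Measurable f) :
    (μ.withDensity f) ⊗ₘ κ = (μ ⊗ₘ κ).withDensity (fun x => f x.1) := by
  refine Measure.ext_of_lintegral _ fun g hg => ?_
  rw [lintegral_compProd hg, lintegral_withDensity_eq_lintegral_mul _ hf (by fun_prop),
    lintegral_withDensity_eq_lintegral_mul _ (by fun_prop) hg,
    lintegral_compProd (by fun_prop)]
  refine lintegral_congr fun x => ?_
  simp only [Pi.mul_apply]
  rw [lintegral_const_mul _ (by fun_prop)]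

lemma map_withDensity_comp (μ : Measure X) {p : X → Y} (hp : Measurable p) {f : Y → ℝ≥0∞}
    (hf : Measurable f) :
    (μ.withDensity (fun x => f (p x))).map p = (μ.map p).withDensity f := by
  refine Measure.ext_of_lintegral _ fun g hg => ?_
  rw [lintegral_map hg hp, lintegral_withDensity_eq_lintegral_mul _ (by fun_prop) (by fun_prop),
    lintegral_withDensity_eq_lintegral_mul _ hf hg, lintegral_map (by fun_prop) hp]
  rfl

lemma compProd_mono_left {μ ν : Measure X} [SFinite μ] [SFinite ν] (h : μ ≤ ν) (κ : Kernel X G)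
    [IsSFiniteKernel κ] : μ ⊗ₘ κ ≤ ν ⊗ₘ κ := by
  refine Measure.le_iff.2 fun s hs => ?_
  rw [compProd_apply hs, compProd_apply hs]
  exact lintegral_mono' h le_rfl

lemma withDensity_mono_measure {μ ν : Measure X} (h : μ ≤ ν) (f : X → ℝ≥0∞) :
    μ.withDensity f ≤ ν.withDensity f := by
  refine Measure.le_iff.2 fun s hs => ?_
  rw [withDensity_apply _ hs, withDensity_apply _ hs]
  exact lintegral_mono' (Measure.restrict_mono le_rfl h) le_rfl

lemma AbsolutelyContinuous.withDensity_same {μ ν : Measure X} (h : μ ≪ ν) {f : X → ℝ≥0∞}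
    (hf : Measurable f) : μ.withDensity f ≪ ν.withDensity f := by
  intro s hs
  rw [withDensity_apply_eq_zero hf] at hs ⊢
  exact h hs

lemma compProd_map_fst_prod (ν : Measure Y) [SFinite ν] {p : Y → X} (hp : Measurable p)
    (κ : Kernel X G) [IsSFiniteKernel κ] :
    (ν ⊗ₘ κ.comap p hp).map (fun y => (p y.1, y.2)) = (ν.map p) ⊗ₘ κ := by
  refine Measure.ext_of_lintegral _ fun g hg => ?_
  rw [lintegral_map hg (by fun_prop), lintegral_compProd (by fun_prop), lintegral_compProd hg,
    lintegral_map (by fun_prop) hp]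
  simp

/-- A mixture representation of `μ ⊗ₘ κ` carries over to any measure `ν` whose image is absolutely
continuous with respect to `μ`. No countability assumption is made on the σ-algebras, so that the
kernels themselves need not agree almost everywhere. -/
lemma compProd_comap_eq_sum {ι : Type*} [Fintype ι] {μ : Measure X} [IsFiniteMeasure μ]
    {κ : Kernel X G} [IsMarkovKernel κ] {η : ι → Kernel X G} [∀ i, IsMarkovKernel (η i)]
    {v : ι → X × G → ℝ≥0∞} (hv : ∀ i, Measurable (v i))
    (h : μ ⊗ₘ κ = ∑ i, (μ ⊗ₘ η i).withDensity (v i))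
    {ν : Measure Y} [IsFiniteMeasure ν] {p : Y → X} (hp : Measurable p) (hν : ν.map p ≪ μ) :
    ν ⊗ₘ κ.comap p hp
      = ∑ i, (ν ⊗ₘ (η i).comap p hp).withDensity (fun y => v i (p y.1, y.2)) := by
  have hmeas : ∀ C, MeasurableSet C → ∀ i,
      Measurable fun x => ∫⁻ g in C, v i (x, g) ∂(η i x) := fun C hC i =>
    Measurable.setLIntegral_kernel_prod_right (f := fun x g => v i (x, g)) (hv i) hC
  -- The exceptional null set may depend on `C`. This is harmless, because two finite measures on a
  -- product are compared on one rectangle at a time.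
  have key : ∀ C, MeasurableSet C →
      (fun x => κ x C) =ᵐ[μ] fun x => ∑ i, ∫⁻ g in C, v i (x, g) ∂(η i x) := by
    intro C hC
    refine ae_eq_of_forall_setLIntegral_eq_of_sigmaFinite (κ.measurable_coe hC)
      (Finset.measurable_sum _ fun i _ => hmeas C hC i) fun A hA _ => ?_
    rw [← compProd_apply_prod hA hC, h, lintegral_finsetSum _ fun i _ => hmeas C hC i, finsetSum_apply]
    refine Finset.sum_congr rfl fun i _ => ?_
    rw [withDensity_apply _ (hA.prod hC), setLIntegral_compProd (hv i) hA hC]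
  refine Measure.ext_prod fun {A} {C} hA hC => ?_
  rw [compProd_apply_prod hA hC, finsetSum_apply]
  have h1 : ∀ᵐ y ∂ν, κ (p y) C = ∑ i, ∫⁻ g in C, v i (p y, g) ∂(η i (p y)) :=
    ae_of_ae_map hp.aemeasurable (hν.ae_le (key C hC))
  simp only [Kernel.comap_apply]
  rw [lintegral_congr_ae (ae_restrict_of_ae h1)]
  rw [lintegral_finsetSum (f := fun i y => ∫⁻ g in C, v i (p y, g) ∂(η i (p y))) _
    fun i _ => (hmeas C hC i).comp hp]
  refine Finset.sum_congr rfl fun i _ => ?_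
  rw [withDensity_apply _ (hA.prod hC), setLIntegral_compProd (by have := hv i; fun_prop) hA hC]
  simp

end MeasureTheory.Measure

/-! ### The trajectory law, one step at a time -/

noncomputable section

namespace PAR

universe uS uA uO uG uW uZ uC uD

variable {S : Type uS} {A : Type uA} {O : Type uO} {G : Type uG} {Ω : Type uW} {Z : Type uZ}
  [MeasurableSpace S] [MeasurableSpace A] [MeasurableSpace O] [MeasurableSpace G]
  [MeasurableSpace Ω] {C : Type uC} [MeasurableSpace C] {C' : Type uD} [MeasurableSpace C']

/-- Append a subgoal and the next observation to a trajectory. -/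
def histCons {k : ℕ} (q : (Hist O G k × G) × O) : Hist O G (k + 1) := (q.1, q.2)

/-- Forget the last observation of a trajectory. -/
def histTail {k : ℕ} (τ : Hist O G (k + 1)) : Hist O G k × G := τ.1

@[fun_prop]
lemma measurable_histCons {k : ℕ} : Measurable (histCons (O := O) (G := G) (k := k)) :=
  measurable_id

@[fun_prop]
lemma measurable_histTail {k : ℕ} : Measurable (histTail (O := O) (G := G) (k := k)) :=
  measurable_fst

omit [MeasurableSpace O] [MeasurableSpace G] in
@[simp] lemma histTail_histCons {k : ℕ} (q : (Hist O G k × G) × O) :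
    histTail (histCons q) = q.1 := rfl

namespace HMDP

variable (M : HMDP S A O G Ω Z)

instance isMarkovKernel_trajState (E : Kernel S O) [IsMarkovKernel E] (z : Z)
    (π : Policy C O G) : ∀ k, IsMarkovKernel (M.trajState E z π k)
  | 0 => by
    unfold trajState
    have : IsProbabilityMeasure ((M.init ⊗ₘ E).map
        (fun p : S × O => (((PUnit.unit, p.2), p.1) : Hist O G 0 × S))) :=
      Measure.isProbabilityMeasure_map (by fun_prop)
    infer_instance
  | k + 1 => by
    have := isMarkovKernel_trajState E z π k
    unfold trajState
    refine Kernel.IsMarkovKernel.map _ ?_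
    have := measurable_histCons (O := O) (G := G) (k := k)
    exact Measurable.prodMk (this.comp (g := histCons)
      (f := fun q : (((Hist O G k × S) × G) × S) × O => ((q.1.1.1.1, q.1.1.2), q.2))
      (by fun_prop)) (by fun_prop)

instance (E : Kernel S O) [IsMarkovKernel E] (z : Z) (π : Policy C O G) (k : ℕ) :
    IsMarkovKernel (M.traj E z π k) := by
  unfold traj
  exact Kernel.IsMarkovKernel.map _ measurable_fst

/-- One step of the environment: the law of the trajectory and of the current state after a high-level
transition and an emission. -/
def advance (E : Kernel S O) (z : Z) (k : ℕ) (ν : Measure ((C × (Hist O G k × S)) × G)) :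
    Measure (C × (Hist O G (k + 1) × S)) :=
  ((ν ⊗ₘ (M.highTrans z k).comap
      (fun p : (C × (Hist O G k × S)) × G => (p.1.2.2, p.2)) (by fun_prop))
    ⊗ₘ E.comap (fun p : ((C × (Hist O G k × S)) × G) × S => p.2) (by fun_prop)).map
      (fun q => (q.1.1.1.1, (histCons ((q.1.1.1.2.1, q.1.1.2), q.2), q.1.2)))

/-- Joint law of the policy's input, the trajectory and the current state. -/
def joint (γ : Measure C) (E : Kernel S O) (z : Z) (π : Policy C O G) (k : ℕ) :
    Measure (C × (Hist O G k × S)) := γ ⊗ₘ M.trajState E z π k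

/-- The policy's subgoal kernel, reading the input and the trajectory but not the state. -/
abbrev stepState (π : Policy C O G) (k : ℕ) : Kernel (C × (Hist O G k × S)) G :=
  (π.step k).comap (fun p => (p.1, p.2.1)) (by fun_prop)

variable {M} {E : Kernel S O} [IsMarkovKernel E] {z : Z} {k : ℕ}

lemma lintegral_advance (ν : Measure ((C × (Hist O G k × S)) × G)) [SFinite ν]
    {f : C × (Hist O G (k + 1) × S) → ℝ≥0∞} (hf : Measurable f) :
    ∫⁻ y, f y ∂(M.advance E z k ν) = ∫⁻ x, ∫⁻ s, ∫⁻ o,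
      f (x.1.1, (histCons ((x.1.2.1, x.2), o), s)) ∂(E s) ∂(M.highTrans z k (x.1.2.2, x.2)) ∂ν := by
  unfold advance
  rw [lintegral_map hf (by fun_prop), Measure.lintegral_compProd (by fun_prop),
    Measure.lintegral_compProd (by fun_prop)]
  simp

instance (ν : Measure ((C × (Hist O G k × S)) × G)) [IsFiniteMeasure ν] :
    IsFiniteMeasure (M.advance E z k ν) := by unfold advance; infer_instance

instance (ν : Measure ((C × (Hist O G k × S)) × G)) [SFinite ν] :
    SFinite (M.advance E z k ν) := by unfold advance; infer_instance

lemma measurable_lintegral_step {f : C × (Hist O G (k + 1) × S) → ℝ≥0∞} (hf : Measurable f) :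
    Measurable fun x : (C × (Hist O G k × S)) × G => ∫⁻ s, ∫⁻ o,
      f (x.1.1, (histCons ((x.1.2.1, x.2), o), s)) ∂(E s)
        ∂(M.highTrans z k (x.1.2.2, x.2)) := by
  have h1 : Measurable fun p : ((C × (Hist O G k × S)) × G) × S => ∫⁻ o,
      f (p.1.1.1, (histCons ((p.1.1.2.1, p.1.2), o), p.2))
        ∂(E.comap (fun p : ((C × (Hist O G k × S)) × G) × S => p.2) (by fun_prop) p) :=
    Measurable.lintegral_kernel_prod_right' (f := fun q : (((C × (Hist O G k × S)) × G) × S) × O =>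
      f (q.1.1.1.1, (histCons ((q.1.1.1.2.1, q.1.1.2), q.2), q.1.2))) (by fun_prop)
  exact Measurable.lintegral_kernel_prod_right' h1 (κ := (M.highTrans z k).comap
      (fun p : (C × (Hist O G k × S)) × G => (p.1.2.2, p.2)) (by fun_prop))

omit [IsMarkovKernel E] in
lemma trajState_succ (π : Policy C O G) :
    M.trajState E z π (k + 1) =
    ((((M.trajState E z π k
      ⊗ₖ (π.step k).comap (fun p : C × (Hist O G k × S) => (p.1, p.2.1)) (by fun_prop))
      ⊗ₖ (M.highTrans z k).comap
        (fun p : C × ((Hist O G k × S) × G) => (p.2.1.2, p.2.2)) (by fun_prop))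
      ⊗ₖ E.comap (fun p : C × (((Hist O G k × S) × G) × S) => p.2.2) (by fun_prop))).map
      (fun q => (histCons ((q.1.1.1.1, q.1.1.2), q.2), q.1.2)) := rfl

lemma lintegral_trajState_succ (π : Policy C O G) {f : Hist O G (k + 1) × S → ℝ≥0∞}
    (hf : Measurable f) (c : C) :
    ∫⁻ y, f y ∂(M.trajState E z π (k + 1) c) = ∫⁻ x, ∫⁻ g, ∫⁻ s, ∫⁻ o,
      f (histCons ((x.1, g), o), s) ∂(E s) ∂(M.highTrans z k (x.2, g)) ∂(π.step k (c, x.1))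
        ∂(M.trajState E z π k c) := by
  have h1 : Measurable fun p : C × ((Hist O G k × S) × G) × S => ∫⁻ o,
      f (histCons ((p.2.1.1.1, p.2.1.2), o), p.2.2)
        ∂(E.comap (fun p : C × (((Hist O G k × S) × G) × S) => p.2.2) (by fun_prop) p) :=
    Measurable.lintegral_kernel_prod_right'
      (f := fun q : (C × ((Hist O G k × S) × G) × S) × O =>
      f (histCons ((q.1.2.1.1.1, q.1.2.1.2), q.2), q.1.2.2)) (by fun_prop)
  have h2 := measurable_lintegral_step (M := M) (E := E) (z := z) (k := k)
    (f := fun x : C × (Hist O G (k + 1) × S) => f x.2) (by fun_prop)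
  rw [trajState_succ, Kernel.map_apply _ (by fun_prop), lintegral_map hf (by fun_prop),
    Kernel.lintegral_compProd _ _ _ (by fun_prop)]
  refine (Kernel.lintegral_compProd _ _ _ (h1.comp measurable_prodMk_left)).trans ?_
  exact Kernel.lintegral_compProd _ _ _
    (h2.comp (f := fun p : (Hist O G k × S) × G => ((c, p.1), p.2)) (by fun_prop))

instance (γ : Measure C) [SFinite γ] (π : Policy C O G) : SFinite (M.joint γ E z π k) := by
  unfold joint; infer_instance

instance (γ : Measure C) [IsFiniteMeasure γ] (π : Policy C O G) :
    IsFiniteMeasure (M.joint γ E z π k) := by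
  unfold joint; infer_instance

/-- Separates the policy from the environment: the policy enters only through `stepState`, and
`advance` is the same for all policies. Comparisons of policies then reduce to one-step comparisons
of subgoals. -/
lemma joint_succ (γ : Measure C) [SFinite γ] (π : Policy C O G) :
    M.joint γ E z π (k + 1) = M.advance E z k (M.joint γ E z π k ⊗ₘ stepState π k) := by
  refine Measure.ext_of_lintegral _ fun f hf => ?_
  have hadv := measurable_lintegral_step (M := M) (E := E) (z := z) (k := k) hf
  rw [lintegral_advance _ hf, Measure.lintegral_compProd hadv]
  unfold joint
  rw [Measure.lintegral_compProd hf, Measure.lintegral_compProd (by fun_prop)]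
  refine lintegral_congr fun c => ?_
  rw [lintegral_trajState_succ π (by fun_prop)]
  rfl

lemma advance_mono {ν ν' : Measure ((C × (Hist O G k × S)) × G)} [SFinite ν] [SFinite ν']
    (h : ν ≤ ν') : M.advance E z k ν ≤ M.advance E z k ν' :=
  Measure.map_mono (Measure.compProd_mono_left (Measure.compProd_mono_left h _) _) (by fun_prop)

lemma map_tail_advance (ν : Measure ((C × (Hist O G k × S)) × G)) [SFinite ν] :
    (M.advance E z k ν).map (fun y => (y.1, histTail y.2.1))
      = ν.map (fun x => (x.1.1, (x.1.2.1, x.2))) := by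
  refine Measure.ext_of_lintegral _ fun f hf => ?_
  rw [lintegral_map hf (by fun_prop), lintegral_advance _ (by fun_prop),
    lintegral_map hf (by fun_prop)]
  simp

/-- The environment's kernels act after the weight is fixed, and the weight reads neither the hidden
state nor the new observation, so it passes through the step. -/
lemma advance_withDensity (ν : Measure ((C × (Hist O G k × S)) × G)) [SFinite ν]
    {w : C × (Hist O G k × G) → ℝ≥0∞} (hw : Measurable w) :
    M.advance E z k (ν.withDensity fun x => w (x.1.1, (x.1.2.1, x.2)))
      = (M.advance E z k ν).withDensity fun y => w (y.1, histTail y.2.1) := by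
  refine Measure.ext_of_lintegral _ fun f hf => ?_
  have hadv := measurable_lintegral_step (M := M) (E := E) (z := z) (k := k) hf
  rw [lintegral_advance _ hf, lintegral_withDensity_eq_lintegral_mul _ (by fun_prop) hadv,
    lintegral_withDensity_eq_lintegral_mul _ (by fun_prop) hf, lintegral_advance _ (by fun_prop)]
  refine lintegral_congr fun x => ?_
  simp only [Pi.mul_apply, histTail_histCons]
  have hE : Measurable fun s : S => ∫⁻ o, f (x.1.1, (histCons ((x.1.2.1, x.2), o), s)) ∂(E s) :=
    Measurable.lintegral_kernel_prod_right' (f := fun p : S × O =>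
      f (x.1.1, (histCons ((x.1.2.1, x.2), p.2), p.1))) (by fun_prop)
  rw [← lintegral_const_mul _ hE]
  refine lintegral_congr fun s => ?_
  rw [← lintegral_const_mul _ (by fun_prop)]

lemma advance_univ (ν : Measure ((C × (Hist O G k × S)) × G)) [SFinite ν] :
    M.advance E z k ν Set.univ = ν Set.univ := by
  have h := lintegral_advance (M := M) (E := E) (z := z) ν (f := fun _ => 1) (by fun_prop)
  simpa using h

lemma joint_univ (γ : Measure C) [SFinite γ] (π : Policy C O G) :
    M.joint γ E z π k Set.univ = γ Set.univ := by
  unfold joint; simp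

/-- The law of the input and the trajectory. -/
lemma compProd_traj (γ : Measure C) [SFinite γ] (π : Policy C O G) :
    γ ⊗ₘ M.traj E z π k = (M.joint γ E z π k).map (fun y => (y.1, y.2.1)) := by
  refine Measure.ext_of_lintegral _ fun f hf => ?_
  rw [lintegral_map hf (by fun_prop), Measure.lintegral_compProd hf]
  unfold joint traj
  rw [Measure.lintegral_compProd (by fun_prop)]
  refine lintegral_congr fun c => ?_
  rw [Kernel.map_apply _ (by fun_prop), lintegral_map (by fun_prop) (by fun_prop)]

/-- Transition and emission are Markov, so forgetting the last observation loses no mass and leaves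
the subgoal just drawn. -/
lemma compProd_traj_succ_map (γ : Measure C) [SFinite γ] (π : Policy C O G) :
    (γ ⊗ₘ M.traj E z π (k + 1)).map (fun y => ((y.1, (histTail y.2).1), (histTail y.2).2))
      = (γ ⊗ₘ M.traj E z π k) ⊗ₘ π.step k := by
  have h1 := map_tail_advance (M := M) (E := E) (z := z) (M.joint γ E z π k ⊗ₘ stepState π k)
  have h2 := Measure.compProd_map_fst_prod (M.joint γ E z π k)
    (p := fun p : C × (Hist O G k × S) => (p.1, p.2.1)) (by fun_prop) (π.step k)
  rw [compProd_traj, compProd_traj, ← h2, joint_succ, Measure.map_map (by fun_prop) (by fun_prop)]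
  have h3 := congrArg (Measure.map
    (fun y : C × (Hist O G k × G) => ((y.1, y.2.1), y.2.2))) h1
  rw [Measure.map_map (by fun_prop) (by fun_prop), Measure.map_map (by fun_prop) (by fun_prop)]
    at h3
  exact h3

lemma trajState_comap (π : Policy C O G) {f : C' → C} (hf : Measurable f) (k : ℕ) :
    M.trajState E z (π.comap f hf) k = (M.trajState E z π k).comap f hf := by
  induction k with
  | zero => rfl
  | succ k ih =>
    ext c : 1
    refine Measure.ext_of_lintegral _ fun φ hφ => ?_
    rw [Kernel.comap_apply, lintegral_trajState_succ _ hφ, lintegral_trajState_succ _ hφ, ih]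
    rfl

lemma traj_comap (π : Policy C O G) {f : C' → C} (hf : Measurable f) (k : ℕ) :
    M.traj E z (π.comap f hf) k = (M.traj E z π k).comap f hf := by
  unfold traj
  rw [trajState_comap]
  ext c : 1
  rw [Kernel.map_apply _ measurable_fst, Kernel.comap_apply, Kernel.comap_apply,
    Kernel.map_apply _ measurable_fst]

end HMDP
end PAR

end

/-! ### Change of policy and comparison of policies -/

noncomputable section

namespace PAR

universe uS uA uO uG uW uZ uC uD

variable {S : Type uS} {A : Type uA} {O : Type uO} {G : Type uG} {Ω : Type uW} {Z : Type uZ}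
  [MeasurableSpace S] [MeasurableSpace A] [MeasurableSpace O] [MeasurableSpace G]
  [MeasurableSpace Ω] {C : Type uC} [MeasurableSpace C]

namespace HMDP

variable {M : HMDP S A O G Ω Z} {E : Kernel S O} [IsMarkovKernel E]

/-- Changing the policy changes the law of the trajectory by a density that does not depend on the
latent variable. -/
lemma exists_joint_eq_withDensity (γ : Measure C) [IsFiniteMeasure γ] (z z' : Z)
    (q b : Policy C O G) (K : ℕ)
    (hac : ∀ k < K, (γ ⊗ₘ M.traj E z q k) ⊗ₘ q.step k ≪ (γ ⊗ₘ M.traj E z q k) ⊗ₘ b.step k) :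
    ∀ k ≤ K, ∃ W : C × Hist O G k → ℝ≥0∞, Measurable W ∧
      M.joint γ E z q k = (M.joint γ E z b k).withDensity (fun y => W (y.1, y.2.1)) ∧
      (M.joint γ E z' b k).withDensity (fun y => W (y.1, y.2.1)) ≤ M.joint γ E z' q k := by
  intro k
  induction k with
  | zero =>
    intro _
    exact ⟨1, measurable_one, withDensity_one.symm, withDensity_one.le⟩
  | succ k ih =>
    intro hk
    obtain ⟨W, hW, hz, hz'⟩ := ih (by omega)
    have hp : Measurable fun y : C × (Hist O G k × S) => (y.1, y.2.1) := by fun_prop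
    set Pb := γ ⊗ₘ M.traj E z b k with hPb
    set Pb' := γ ⊗ₘ M.traj E z' b k with hPb'
    set Pq := γ ⊗ₘ M.traj E z q k with hPq
    -- The one-step density `v` below is determined only up to sets that are null under `z`, while
    -- the law under `z'` may charge such sets. Cutting `W` down to `N` costs nothing under `z`;
    -- under `z'` it only shrinks the measure, hence the inequality in the conclusion.
    have hs := Measure.mutuallySingular_singularPart Pb' Pb
    set N := hs.nullSet with hN
    have hNm : MeasurableSet N := hs.measurableSet_nullSet
    have hrestr : Pb'.restrict N ≪ Pb := by
      rw [Pb'.haveLebesgueDecomposition_add Pb, Measure.restrict_add, hs.restrict_nullSet, zero_add]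
      exact Measure.restrict_le_self.absolutelyContinuous.trans
        (withDensity_absolutelyContinuous _ _)
    have hPqW : Pq = Pb.withDensity W := by
      rw [hPq, compProd_traj, hz, Measure.map_withDensity_comp _ hp hW, hPb, compProd_traj]
    set W0 := N.indicator W with hW0
    have hW0m : Measurable W0 := hW.indicator hNm
    have hz0 : M.joint γ E z q k
        = (M.joint γ E z b k).withDensity (fun y => W0 (y.1, y.2.1)) := by
      rw [hz]
      refine withDensity_congr_ae ?_
      have : ∀ᵐ x ∂Pb, x ∈ N := by
        rw [ae_iff]; exact hs.measure_compl_nullSet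
      rw [hPb, compProd_traj] at this
      filter_upwards [ae_of_ae_map hp.aemeasurable this] with y hy
      simp [hW0, Set.indicator_of_mem hy]
    have hz0' : (M.joint γ E z' b k).withDensity (fun y => W0 (y.1, y.2.1))
        ≤ M.joint γ E z' q k :=
      (withDensity_mono (ae_of_all _ fun y => Set.indicator_le_self _ _ _)).trans hz'
    set ν' := (M.joint γ E z' b k).withDensity (fun y => W0 (y.1, y.2.1)) with hν'
    have : IsFiniteMeasure ν' := isFiniteMeasure_of_le _ hz0'
    have hν'ac : ν'.map (fun y => (y.1, y.2.1)) ≪ Pq := by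
      rw [hν', Measure.map_withDensity_comp _ hp hW0m, ← compProd_traj, hW0,
        withDensity_indicator hNm, hPqW]
      exact hrestr.withDensity_same hW
    set v := (Pq ⊗ₘ q.step k).rnDeriv (Pq ⊗ₘ b.step k) with hv
    have hvm : Measurable v := Measure.measurable_rnDeriv _ _
    have hvq : Pq ⊗ₘ q.step k = ∑ _i : Unit, (Pq ⊗ₘ b.step k).withDensity v := by
      simp only [Finset.univ_unique, Finset.sum_const, Finset.card_singleton, one_smul]
      exact (Measure.withDensity_rnDeriv_eq _ _ (hac k (by omega))).symm
    -- The identity defining `v` holds over the trajectory law under `z`. It is moved to measures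
    -- that also carry the hidden state, and to the cut-down law under `z'`.
    have tr := fun (ν : Measure (C × (Hist O G k × S))) (_ : IsFiniteMeasure ν)
        (hν : ν.map (fun y => (y.1, y.2.1)) ≪ Pq) =>
      Measure.compProd_comap_eq_sum (ι := Unit) (η := fun _ => b.step k) (v := fun _ => v)
        (fun _ => hvm) hvq hp hν
    simp only [Finset.univ_unique, Finset.sum_const, Finset.card_singleton, one_smul] at tr
    have hw : Measurable fun x : C × (Hist O G k × G) =>
      W0 (x.1, x.2.1) * v ((x.1, x.2.1), x.2.2) := by fun_prop
    have dens : ∀ y : Z, ((M.joint γ E y b k).withDensity (fun y => W0 (y.1, y.2.1))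
          ⊗ₘ stepState b k).withDensity (fun y => v ((y.1.1, y.1.2.1), y.2))
        = (M.joint γ E y b k ⊗ₘ stepState b k).withDensity
          (fun x => W0 (x.1.1, x.1.2.1) * v ((x.1.1, x.1.2.1), x.2)) := by
      intro y
      rw [Measure.withDensity_compProd _ _ (by fun_prop), ← withDensity_mul _ (by fun_prop)
        (by fun_prop)]
      rfl
    refine ⟨fun x => W0 (x.1, (histTail x.2).1) * v ((x.1, (histTail x.2).1), (histTail x.2).2),
      by fun_prop, ?_, ?_⟩
    · rw [joint_succ, joint_succ, ← advance_withDensity _ hw]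
      congr 1
      rw [← dens z, ← hz0]
      exact tr _ inferInstance (by rw [hPq, compProd_traj])
    · rw [joint_succ, joint_succ, ← advance_withDensity _ hw]
      refine advance_mono ?_
      rw [← dens z', ← hν']
      exact (tr ν' inferInstance hν'ac).symm.le.trans (Measure.compProd_mono_left hz0' _)

/-- The density never reads the hidden state, so it survives projection to the observable
trajectory. -/
lemma exists_traj_eq_withDensity (γ : Measure C) [IsFiniteMeasure γ] (z z' : Z)
    (q b : Policy C O G) (k : ℕ)
    (hac : ∀ j < k, (γ ⊗ₘ M.traj E z q j) ⊗ₘ q.step j ≪ (γ ⊗ₘ M.traj E z q j) ⊗ₘ b.step j) :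
    ∃ W : C × Hist O G k → ℝ≥0∞, Measurable W ∧
      γ ⊗ₘ M.traj E z q k = (γ ⊗ₘ M.traj E z b k).withDensity W ∧
      (γ ⊗ₘ M.traj E z' b k).withDensity W ≤ γ ⊗ₘ M.traj E z' q k := by
  obtain ⟨W, hW, h1, h2⟩ := exists_joint_eq_withDensity γ z z' q b k hac k le_rfl
  have hp : Measurable fun y : C × (Hist O G k × S) => (y.1, y.2.1) := by fun_prop
  refine ⟨W, hW, ?_, ?_⟩
  · rw [compProd_traj, h1, Measure.map_withDensity_comp _ hp hW, compProd_traj]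
  · rw [compProd_traj, compProd_traj, ← Measure.map_withDensity_comp _ hp hW]
    exact Measure.map_mono h2 hp

/-- Two policies that agree up to a subprobability share a large part of their joint laws. -/
lemma exists_common_part (γ : Measure C) [IsFiniteMeasure γ] (z : Z) (q e : Policy C O G)
    (r : ∀ k, C × Hist O G k → ℝ≥0∞) (hr : ∀ k, Measurable (r k)) (hr1 : ∀ k x, r k x ≤ 1)
    (K : ℕ)
    (h : ∀ k < K, ((M.joint γ E z q k).withDensity (fun y => r k (y.1, y.2.1))) ⊗ₘ stepState e k
      ≤ M.joint γ E z q k ⊗ₘ stepState q k) :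
    ∀ k ≤ K, ∃ ν : Measure (C × (Hist O G k × S)), ν ≤ M.joint γ E z q k ∧
      ν ≤ M.joint γ E z e k ∧
      γ Set.univ ≤ ν Set.univ
        + ∑ j ∈ Finset.range k, ∫⁻ x, (1 - r j x) ∂(γ ⊗ₘ M.traj E z q j) := by
  intro k
  induction k with
  | zero =>
    intro _
    exact ⟨M.joint γ E z q 0, le_rfl, le_rfl, by simp [joint_univ]⟩
  | succ k ih =>
    intro hk
    obtain ⟨ν, hq, he, hm⟩ := ih (by omega)
    have hf : IsFiniteMeasure ν := isFiniteMeasure_of_le _ hq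
    have hp : Measurable fun y : C × (Hist O G k × S) => (y.1, y.2.1) := by fun_prop
    have hrp : Measurable fun y : C × (Hist O G k × S) => r k (y.1, y.2.1) := (hr k).comp hp
    have hle : ν.withDensity (fun y => r k (y.1, y.2.1)) ≤ ν := by
      conv_rhs => rw [← withDensity_one (μ := ν)]
      exact withDensity_mono (ae_of_all _ fun y => hr1 k _)
    -- The common part continues with `e`'s subgoals, kept with weight `r k`: hypothesis `h` places
    -- it below the law of `q`, and `r k ≤ 1` below the law of `e`. The mass lost is the integral of
    -- `1 - r k` against `ν`, which is below the law of `q`.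
    refine ⟨M.advance E z k (ν.withDensity (fun y => r k (y.1, y.2.1)) ⊗ₘ stepState e k),
      ?_, ?_, ?_⟩
    · rw [joint_succ]
      exact advance_mono ((Measure.compProd_mono_left (Measure.withDensity_mono_measure hq _) _).trans
        (h k (by omega)))
    · rw [joint_succ]
      exact advance_mono (Measure.compProd_mono_left (hle.trans he) _)
    · rw [advance_univ, Measure.compProd_apply_univ, withDensity_apply _ MeasurableSet.univ,
        Measure.restrict_univ, Finset.sum_range_succ, add_comm (∑ j ∈ _, _), ← add_assoc]
      refine hm.trans (add_le_add ?_ le_rfl)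
      have hsub : Measurable fun x => 1 - r k x := measurable_const.sub (hr k)
      have h1 : ∫⁻ x, (1 - r k x) ∂(γ ⊗ₘ M.traj E z q k)
          = ∫⁻ y, (1 - r k (y.1, y.2.1)) ∂(M.joint γ E z q k) := by
        rw [compProd_traj, lintegral_map hsub hp]
      have h2 : ν Set.univ = ∫⁻ y, (r k (y.1, y.2.1) + (1 - r k (y.1, y.2.1))) ∂ν := by
        rw [← lintegral_one]
        exact lintegral_congr fun y => (add_tsub_cancel_of_le (hr1 k _)).symm
      rw [h1, h2, lintegral_add_left hrp]
      exact add_le_add le_rfl (lintegral_mono' hq le_rfl)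

/-- Performance comparison of two policies. -/
lemma lintegral_traj_le (γ : Measure C) [IsFiniteMeasure γ] (z : Z) (q e : Policy C O G)
    (r : ∀ k, C × Hist O G k → ℝ≥0∞) (hr : ∀ k, Measurable (r k)) (hr1 : ∀ k x, r k x ≤ 1)
    (k : ℕ)
    (h : ∀ j < k, ((M.joint γ E z q j).withDensity (fun y => r j (y.1, y.2.1))) ⊗ₘ stepState e j
      ≤ M.joint γ E z q j ⊗ₘ stepState q j)
    {R : C × Hist O G k → ℝ≥0∞} (hR : Measurable R) {B : ℝ≥0∞} (hB : ∀ x, R x ≤ B) :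
    ∫⁻ x, R x ∂(γ ⊗ₘ M.traj E z e k) ≤ ∫⁻ x, R x ∂(γ ⊗ₘ M.traj E z q k)
      + B * ∑ j ∈ Finset.range k, ∫⁻ x, (1 - r j x) ∂(γ ⊗ₘ M.traj E z q j) := by
  obtain ⟨ν, hq, he, hm⟩ := exists_common_part γ z q e r hr hr1 k h k le_rfl
  have hf : IsFiniteMeasure ν := isFiniteMeasure_of_le _ hq
  have hp : Measurable fun y : C × (Hist O G k × S) => (y.1, y.2.1) := by fun_prop
  rw [compProd_traj, compProd_traj, lintegral_map hR hp, lintegral_map hR hp]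
  -- Only the excess of `e` over the common part can gain reward, at most `B` per unit of mass.
  have hdec : M.joint γ E z e k = (M.joint γ E z e k - ν) + ν :=
    (Measure.sub_add_cancel_of_le he).symm
  have hmass : (M.joint γ E z e k - ν) Set.univ
      ≤ ∑ j ∈ Finset.range k, ∫⁻ x, (1 - r j x) ∂(γ ⊗ₘ M.traj E z q j) := by
    rw [Measure.sub_apply MeasurableSet.univ he, joint_univ]
    exact tsub_le_iff_left.2 hm
  rw [hdec, lintegral_add_measure, add_comm]
  refine add_le_add (lintegral_mono' hq le_rfl) ?_
  calc ∫⁻ y, R (y.1, y.2.1) ∂(M.joint γ E z e k - ν)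
      ≤ ∫⁻ _, B ∂(M.joint γ E z e k - ν) := lintegral_mono fun y => hB _
    _ = B * (M.joint γ E z e k - ν) Set.univ := lintegral_const _
    _ ≤ _ := by gcongr

end HMDP
end PAR

end

/-! ### Likelihood ratios, posterior odds and Hellinger affinity -/

noncomputable section

namespace PAR

universe uS uA uO uG uW uZ uC uD

section Density

variable {X Y : Type*} [MeasurableSpace X] [MeasurableSpace Y]

lemma ENNReal_rpow_half_mul_self (x : ℝ≥0∞) : x ^ (1 / 2 : ℝ) * x ^ (1 / 2 : ℝ) = x := by
  rw [← ENNReal.rpow_add_of_nonneg _ _ (by norm_num) (by norm_num)]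
  norm_num

lemma two_mul_rpow_half_le (x : ℝ≥0∞) : 2 * x ^ (1 / 2 : ℝ) ≤ 1 + x := by
  rcases eq_or_ne x ∞ with rfl | hx
  · simp
  have hy : x ^ (1 / 2 : ℝ) ≠ ∞ := ENNReal.rpow_ne_top_of_nonneg (by norm_num) hx
  conv_rhs => rw [← ENNReal_rpow_half_mul_self x]
  lift x ^ (1 / 2 : ℝ) to NNReal using hy with y
  norm_cast
  have := two_mul_le_add_sq (1 : ℝ) y
  rw [← NNReal.coe_le_coe]
  push_cast
  nlinarith

/-- Off a `μ`-null set, `f` dominates the density of `μ'` with respect to `μ`. -/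
def HasDensityBound (μ' μ : Measure X) (f : X → ℝ≥0∞) : Prop :=
  ∃ N, MeasurableSet N ∧ μ N = 0 ∧ μ'.restrict Nᶜ ≤ μ.withDensity f

lemma hasDensityBound_rnDeriv (μ' μ : Measure X) [IsFiniteMeasure μ'] [IsFiniteMeasure μ] :
    HasDensityBound μ' μ (μ'.rnDeriv μ) := by
  obtain ⟨N, hN, h0, h1⟩ := Measure.mutuallySingular_singularPart μ' μ
  refine ⟨Nᶜ, hN.compl, h1, ?_⟩
  rw [compl_compl]
  conv_lhs => rw [μ'.haveLebesgueDecomposition_add μ]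
  rw [Measure.restrict_add, Measure.restrict_eq_zero.2 h0, zero_add]
  exact Measure.restrict_le_self

/-- Makes likelihood ratios multiply across independent episodes, with no absolute continuity of
`μ'` required. -/
lemma HasDensityBound.prod {μ' μ : Measure X} {ν' ν : Measure Y} [IsFiniteMeasure μ]
    [IsFiniteMeasure μ'] [IsFiniteMeasure ν] [IsFiniteMeasure ν'] {f : X → ℝ≥0∞} {g : Y → ℝ≥0∞}
    (hf : Measurable f) (hg : Measurable g)
    (h1 : HasDensityBound μ' μ f) (h2 : HasDensityBound ν' ν g) :
    HasDensityBound (μ'.prod ν') (μ.prod ν) (fun x => f x.1 * g x.2) := by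
  obtain ⟨N, hN, hN0, hle⟩ := h1
  obtain ⟨N', hN', hN0', hle'⟩ := h2
  refine ⟨(Nᶜ ×ˢ N'ᶜ)ᶜ, (hN.compl.prod hN'.compl).compl, ?_, ?_⟩
  · rw [Set.compl_prod_eq_union]
    refine measure_union_null ?_ ?_ <;> simp [Measure.prod_prod, hN0, hN0']
  · rw [compl_compl, ← Measure.prod_restrict, ← prod_withDensity hf hg]
    exact Measure.prod_mono hle hle'

lemma HasDensityBound.map {μ' μ : Measure X} (e : X ≃ᵐ Y) {f : Y → ℝ≥0∞} (hf : Measurable f)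
    (h : HasDensityBound μ' μ (fun x => f (e x))) :
    HasDensityBound (μ'.map e) (μ.map e) f := by
  obtain ⟨N, hN, hN0, hle⟩ := h
  refine ⟨e.symm ⁻¹' N, e.symm.measurable hN, ?_, ?_⟩
  · rw [Measure.map_apply e.measurable (e.symm.measurable hN), ← Set.preimage_comp]
    simpa using hN0
  · rw [← Measure.map_withDensity_comp _ e.measurable hf,
      Measure.restrict_map e.measurable (e.symm.measurable hN).compl, ← Set.preimage_compl,
      ← Set.preimage_comp]
    simpa using Measure.map_mono hle e.measurable

/-- Posterior odds are bounded by the prior odds times the likelihood ratio. -/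
lemma HasDensityBound.rnDeriv_le {μ μ' P : Measure X} [IsFiniteMeasure μ] [IsFiniteMeasure μ']
    [IsFiniteMeasure P] {p p' c : ℝ≥0∞} (hμ : p • μ ≤ P) (hμ' : p' • μ' ≤ P)
    (hp : p ≠ 0) (hc : p' ≤ c * p) {f : X → ℝ≥0∞} (hf : Measurable f)
    (h : HasDensityBound μ' μ f) :
    ∀ᵐ x ∂μ, (p' • μ').rnDeriv P x ≤ c * f x := by
  obtain ⟨N, hN, hN0, hle⟩ := h
  set a := (p • μ).rnDeriv P with ha
  set a' := (p' • μ').rnDeriv P with ha'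
  have : IsFiniteMeasure (p • μ) := isFiniteMeasure_of_le _ hμ
  have : IsFiniteMeasure (p' • μ') := isFiniteMeasure_of_le _ hμ'
  have hP : P.withDensity a = p • μ :=
    Measure.withDensity_rnDeriv_eq _ _ (Measure.absolutelyContinuous_of_le hμ)
  have hP' : P.withDensity a' = p' • μ' :=
    Measure.withDensity_rnDeriv_eq _ _ (Measure.absolutelyContinuous_of_le hμ')
  have ha1 : a ≤ᵐ[P] 1 := Measure.rnDeriv_le_one_of_le hμ
  have ham : Measurable a := Measure.measurable_rnDeriv _ _
  have ham' : Measurable a' := Measure.measurable_rnDeriv _ _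
  -- Off `N`, `p' μ' ≤ c p f μ`, and `p μ` has density `a ≤ 1` with respect to `P`. Replacing `a` by
  -- `1` turns the bound on odds into a bound on `a'` itself.
  have hcomp : P.withDensity (Nᶜ.indicator a') ≤ P.withDensity (fun x => c * f x) := by
    calc P.withDensity (Nᶜ.indicator a') = p' • μ'.restrict Nᶜ := by
          rw [withDensity_indicator hN.compl, ← restrict_withDensity hN.compl, hP',
            Measure.restrict_smul]
      _ ≤ (c * p) • μ.withDensity f :=
          Measure.le_iff.2 fun s hs => by
            simp only [Measure.smul_apply, smul_eq_mul]
            exact mul_le_mul' hc (hle s)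
      _ = (P.withDensity a).withDensity (fun x => c * f x) := by
          rw [hP, withDensity_smul_measure, mul_comm, mul_smul]
          congr 1
          exact (withDensity_smul c hf).symm
      _ = P.withDensity (fun x => a x * (c * f x)) := by
          rw [← withDensity_mul _ ham (by fun_prop)]; rfl
      _ ≤ P.withDensity (fun x => c * f x) := by
          refine withDensity_mono ?_
          filter_upwards [ha1] with x hx
          exact mul_le_of_le_one_left' hx
  have hae : Nᶜ.indicator a' ≤ᵐ[P] fun x => c * f x := by
    refine ae_le_of_forall_setLIntegral_le_of_sigmaFinite (ham'.indicator hN.compl)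
      fun s hs _ => ?_
    rw [← withDensity_apply _ hs, ← withDensity_apply _ hs]
    exact hcomp s
  have hμP : μ ≪ P := (Measure.absolutelyContinuous_smul hp).trans
    (Measure.absolutelyContinuous_of_le hμ)
  have hNae : ∀ᵐ x ∂μ, x ∈ Nᶜ := by rw [ae_iff]; simpa using hN0
  filter_upwards [hμP.ae_le hae, hNae] with x hx hxN
  rwa [Set.indicator_of_mem hxN] at hx

lemma one_le_sum_rnDeriv {ι : Type*} [Fintype ι] (μ : ι → Measure X) [∀ i, IsFiniteMeasure (μ i)] :
    ∀ᵐ x ∂(∑ i, μ i), 1 ≤ ∑ i, (μ i).rnDeriv (∑ i, μ i) x := by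
  have hle : ∀ i, μ i ≤ ∑ i, μ i := fun i =>
    Measure.le_iff.2 fun s _ => by
      rw [Measure.finsetSum_apply]
      exact Finset.single_le_sum (f := fun i => μ i s) (fun _ _ => zero_le) (Finset.mem_univ i)
  refine ae_le_of_forall_setLIntegral_le_of_sigmaFinite measurable_const fun s hs _ => ?_
  rw [lintegral_finsetSum _ fun i _ => Measure.measurable_rnDeriv _ _]
  simp only [setLIntegral_one]
  rw [Measure.finsetSum_apply]
  refine Finset.sum_le_sum fun i _ => ?_
  rw [Measure.setLIntegral_rnDeriv (Measure.absolutelyContinuous_of_le (hle i))]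

/-- Integrate `2 √f ≤ 1 + f`. This is the bound of an affinity by `1`, in a form that only asks the
tilted measure to lie below `ν'`. -/
lemma lintegral_rpow_half_le {ν ν' : Measure X} {f : X → ℝ≥0∞} (hf : Measurable f)
    (h : ν.withDensity f ≤ ν') :
    2 * ∫⁻ x, f x ^ (1 / 2 : ℝ) ∂ν ≤ ν Set.univ + ν' Set.univ := by
  rw [← lintegral_const_mul _ (by fun_prop)]
  calc ∫⁻ x, 2 * f x ^ (1 / 2 : ℝ) ∂ν ≤ ∫⁻ x, (1 + f x) ∂ν :=
        lintegral_mono fun x => two_mul_rpow_half_le _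
    _ = ν Set.univ + ν.withDensity f Set.univ := by
        rw [lintegral_add_left measurable_const, lintegral_one,
          withDensity_apply _ MeasurableSet.univ, Measure.restrict_univ]
    _ ≤ _ := add_le_add le_rfl (h _)

lemma ofReal_sqrt_toReal {x : ℝ≥0∞} (hx : x ≠ ∞) : ENNReal.ofReal √x.toReal = x ^ (1 / 2 : ℝ) := by
  rw [Real.sqrt_eq_rpow, ← ENNReal.ofReal_rpow_of_nonneg ENNReal.toReal_nonneg (by norm_num),
    ENNReal.ofReal_toReal hx]

lemma integrable_affinity (ν ν' : Measure X) [IsProbabilityMeasure ν] [IsProbabilityMeasure ν'] :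
    Integrable (fun x => √(ν.rnDeriv (ν + ν') x).toReal * √(ν'.rnDeriv (ν + ν') x).toReal)
      (ν + ν') := by
  set σ := ν + ν' with hσ
  have hi : Integrable (fun x => (ν.rnDeriv σ x).toReal) σ := Measure.integrable_toReal_rnDeriv
  have hi' : Integrable (fun x => (ν'.rnDeriv σ x).toReal) σ := Measure.integrable_toReal_rnDeriv
  have hm := Measure.measurable_rnDeriv ν σ
  have hm' := Measure.measurable_rnDeriv ν' σ
  refine (hi.add hi').mono' (by fun_prop) (ae_of_all _ fun x => ?_)
  have h1 := Real.sq_sqrt (ENNReal.toReal_nonneg (a := ν.rnDeriv σ x))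
  have h2 := Real.sq_sqrt (ENNReal.toReal_nonneg (a := ν'.rnDeriv σ x))
  rw [Real.norm_of_nonneg (by positivity)]
  simp only [Pi.add_apply]
  nlinarith [sq_nonneg (√(ν.rnDeriv σ x).toReal - √(ν'.rnDeriv σ x).toReal),
    sq_nonneg (√(ν.rnDeriv σ x).toReal + √(ν'.rnDeriv σ x).toReal)]

/-- Expand the square; the two densities integrate to one each. -/
lemma one_sub_hellingerSq (ν ν' : Measure X) [IsProbabilityMeasure ν] [IsProbabilityMeasure ν'] :
    1 - hellingerSq ν ν'
      = ∫ x, √(ν.rnDeriv (ν + ν') x).toReal * √(ν'.rnDeriv (ν + ν') x).toReal ∂(ν + ν') := by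
  have hprod := integrable_affinity ν ν'
  set σ := ν + ν' with hσ
  have hac : ν ≪ σ := Measure.absolutelyContinuous_of_le (Measure.le_add_right le_rfl)
  have hac' : ν' ≪ σ := Measure.absolutelyContinuous_of_le (Measure.le_add_left le_rfl)
  have hi : Integrable (fun x => (ν.rnDeriv σ x).toReal) σ := Measure.integrable_toReal_rnDeriv
  have hi' : Integrable (fun x => (ν'.rnDeriv σ x).toReal) σ := Measure.integrable_toReal_rnDeriv
  have : ∀ x, (√(ν.rnDeriv σ x).toReal - √(ν'.rnDeriv σ x).toReal) ^ 2
      = ((ν.rnDeriv σ x).toReal + (ν'.rnDeriv σ x).toReal)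
        - 2 * (√(ν.rnDeriv σ x).toReal * √(ν'.rnDeriv σ x).toReal) := by
    intro x
    have h1 := Real.sq_sqrt (ENNReal.toReal_nonneg (a := ν.rnDeriv σ x))
    have h2 := Real.sq_sqrt (ENNReal.toReal_nonneg (a := ν'.rnDeriv σ x))
    nlinarith
  unfold hellingerSq
  rw [← hσ]
  simp only [this]
  have hadd : Integrable
      (fun x => (ν.rnDeriv σ x).toReal + (ν'.rnDeriv σ x).toReal) σ := hi.add hi'
  rw [integral_sub hadd (hprod.const_mul 2), integral_add hi hi', integral_const_mul,
    Measure.integral_toReal_rnDeriv hac, Measure.integral_toReal_rnDeriv hac']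
  simp
  ring

lemma hellingerSq_le_one (ν ν' : Measure X) [IsProbabilityMeasure ν] [IsProbabilityMeasure ν'] :
    hellingerSq ν ν' ≤ 1 := by
  have h := one_sub_hellingerSq ν ν'
  have h1 : 0 ≤ 1 - hellingerSq ν ν' := h ▸ integral_nonneg fun x => by positivity
  linarith

lemma lintegral_affinity (ν ν' : Measure X) [IsProbabilityMeasure ν] [IsProbabilityMeasure ν'] :
    ∫⁻ x, ν.rnDeriv (ν + ν') x ^ (1 / 2 : ℝ) * ν'.rnDeriv (ν + ν') x ^ (1 / 2 : ℝ) ∂(ν + ν')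
      = ENNReal.ofReal (1 - hellingerSq ν ν') := by
  rw [one_sub_hellingerSq, ofReal_integral_eq_lintegral_ofReal (integrable_affinity ν ν')
    (ae_of_all _ fun x => by positivity)]
  refine lintegral_congr_ae ?_
  filter_upwards [Measure.rnDeriv_lt_top ν (ν + ν'), Measure.rnDeriv_lt_top ν' (ν + ν')]
    with x hx hx'
  rw [ENNReal.ofReal_mul (by positivity), ofReal_sqrt_toReal hx.ne, ofReal_sqrt_toReal hx'.ne]

/-- With `p`, `q` the densities of `ν`, `ν'` with respect to their sum, the hypothesis says `p f ≤
q` almost everywhere, so `p √f ≤ √(p q)`, whose integral is the affinity. -/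
lemma lintegral_rpow_half_le_hellinger (γ : Measure X) [IsFiniteMeasure γ] (ν ν' : Measure Y)
    [IsProbabilityMeasure ν] [IsProbabilityMeasure ν'] {f : X × Y → ℝ≥0∞} (hf : Measurable f)
    (h : (γ.prod ν).withDensity f ≤ γ.prod ν') :
    ∫⁻ x, f x ^ (1 / 2 : ℝ) ∂(γ.prod ν)
      ≤ γ Set.univ * ENNReal.ofReal (1 - hellingerSq ν ν') := by
  set σ := ν + ν' with hσ
  have hac : ν ≪ σ := Measure.absolutelyContinuous_of_le (Measure.le_add_right le_rfl)
  have hac' : ν' ≪ σ := Measure.absolutelyContinuous_of_le (Measure.le_add_left le_rfl)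
  set p := ν.rnDeriv σ with hp
  set q := ν'.rnDeriv σ with hq
  have hpm : Measurable p := Measure.measurable_rnDeriv _ _
  have hqm : Measurable q := Measure.measurable_rnDeriv _ _
  have hν : γ.prod ν = (γ.prod σ).withDensity (fun x => p x.2) := by
    rw [← prod_withDensity_right hpm, Measure.withDensity_rnDeriv_eq _ _ hac]
  have hν' : γ.prod ν' = (γ.prod σ).withDensity (fun x => q x.2) := by
    rw [← prod_withDensity_right hqm, Measure.withDensity_rnDeriv_eq _ _ hac']
  rw [hν, hν', ← withDensity_mul _ (by fun_prop) hf] at h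
  have hae : ∀ᵐ x ∂(γ.prod σ), p x.2 * f x ≤ q x.2 := by
    refine ae_le_of_forall_setLIntegral_le_of_sigmaFinite (by fun_prop) fun s hs _ => ?_
    have := h s
    rwa [withDensity_apply _ hs, withDensity_apply _ hs] at this
  rw [hν, lintegral_withDensity_eq_lintegral_mul _ (by fun_prop) (by fun_prop)]
  calc ∫⁻ x, p x.2 * f x ^ (1 / 2 : ℝ) ∂(γ.prod σ)
      ≤ ∫⁻ x, 1 * (p x.2 ^ (1 / 2 : ℝ) * q x.2 ^ (1 / 2 : ℝ)) ∂(γ.prod σ) := by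
        refine lintegral_mono_ae ?_
        filter_upwards [hae] with x hx
        conv_lhs => rw [← ENNReal_rpow_half_mul_self (p x.2)]
        rw [one_mul, mul_assoc, ← ENNReal.mul_rpow_of_nonneg _ _ (by norm_num)]
        gcongr
    _ = _ := by
        rw [lintegral_prod_mul (f := fun _ => 1) (g := fun y => p y ^ (1 / 2 : ℝ) * q y ^ (1 / 2 : ℝ))
          (by fun_prop) (by fun_prop), lintegral_one, lintegral_affinity]

end Density

end PAR

end

/-! ### Likelihoods of contexts and prompts under pretraining -/

noncomputable section

namespace PAR

universe uS uA uO uG uW uZ uC uD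

variable {S : Type uS} {A : Type uA} {O : Type uO} {G : Type uG} {Ω : Type uW} {Z : Type uZ}
  [MeasurableSpace S] [MeasurableSpace A] [MeasurableSpace O] [MeasurableSpace G]
  [MeasurableSpace Ω]

lemma prod_compProd_comap_snd {X Y W : Type*} [MeasurableSpace X] [MeasurableSpace Y]
    [MeasurableSpace W] (μ : Measure X) [SFinite μ] (ν : Measure Y) [SFinite ν] (κ : Kernel Y W)
    [IsSFiniteKernel κ] :
    (μ.prod ν) ⊗ₘ κ.comap Prod.snd measurable_snd
      = (μ.prod (ν ⊗ₘ κ)).map (MeasurableEquiv.prodAssoc (α := X) (β := Y) (γ := W)).symm := by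
  refine Measure.ext_of_lintegral _ fun f hf => ?_
  have h : Measurable fun x : X × Y × W => f ((x.1, x.2.1), x.2.2) := by fun_prop
  rw [lintegral_map hf (MeasurableEquiv.measurable _), Measure.lintegral_compProd hf,
    lintegral_prod _ (Measurable.aemeasurable
      (Measurable.lintegral_kernel_prod_right' hf)),
    lintegral_prod (fun x : X × Y × W => f (MeasurableEquiv.prodAssoc.symm x)) h.aemeasurable]
  refine lintegral_congr fun x => ?_
  exact (Measure.lintegral_compProd (h.comp measurable_prodMk_left)).symm

namespace Pretraining

variable {M : HMDP S A O G Ω Z} (D : Pretraining M)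

/-- Law of the context under `ℙ_𝒟(· | z)`. -/
def ctxLawGiven (z : Z) (t : ℕ) : Measure (Ctx Ω O G M.H t) :=
  M.contextLaw (fun _ => D.taskLaw)
    (fun _ k => M.traj M.emission z (D.behavior.comap Prod.snd measurable_snd) k) t

/-- Law of the task and of the trajectory of one episode under `ℙ_𝒟(· | z)`. -/
def episodeLaw (z : Z) (k : ℕ) : Measure (Ω × Hist O G k) :=
  D.taskLaw ⊗ₘ M.traj M.emission z D.behavior k

/-- Likelihood ratio of `z'` against `z` in one episode. -/
def lik (z' z : Z) (k : ℕ) : Ω × Hist O G k → ℝ≥0∞ :=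
  (D.episodeLaw z' k).rnDeriv (D.episodeLaw z k)

/-- Likelihood ratio of `z'` against `z` for a context. -/
def ctxLik (z' z : Z) : ∀ t, Ctx Ω O G M.H t → ℝ≥0∞
  | 0, _ => 1
  | t + 1, c => ctxLik z' z t (c : Prompt Ω O G M.H t (M.H - 1)).1.1
      * D.lik z' z (M.H - 1)
        ((c : Prompt Ω O G M.H t (M.H - 1)).1.2, (c : Prompt Ω O G M.H t (M.H - 1)).2)

/-- Likelihood ratio of `z'` against `z` for a prompt. -/
def promptLik (z' z : Z) (t k : ℕ) (p : Prompt Ω O G M.H t k) : ℝ≥0∞ :=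
  D.ctxLik z' z t p.1.1 * D.lik z' z k (p.1.2, p.2)

@[fun_prop]
lemma measurable_lik (z' z : Z) (k : ℕ) : Measurable (D.lik z' z k) :=
  Measure.measurable_rnDeriv _ _

@[fun_prop]
lemma measurable_ctxLik (z' z : Z) : ∀ t, Measurable (D.ctxLik z' z t)
  | 0 => measurable_const
  | t + 1 => by
    have := measurable_ctxLik z' z t
    have h : Measurable (D.promptLik z' z t (M.H - 1)) := by unfold promptLik; fun_prop
    exact h

@[fun_prop]
lemma measurable_promptLik (z' z : Z) (t k : ℕ) : Measurable (D.promptLik z' z t k) := by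
  unfold promptLik; fun_prop

instance (z : Z) (k : ℕ) : IsProbabilityMeasure (D.episodeLaw z k) := by
  unfold episodeLaw; infer_instance

lemma promptLawGiven_eq (z : Z) (t k : ℕ) :
    D.promptLawGiven z t k = (D.ctxLawGiven z t).prod D.taskLaw
      ⊗ₘ M.traj M.emission z (D.behavior.comap Prod.snd measurable_snd) k := rfl

instance isProbabilityMeasure_ctxLawGiven (z : Z) :
    ∀ t, IsProbabilityMeasure (D.ctxLawGiven z t)
  | 0 => inferInstanceAs (IsProbabilityMeasure (Measure.dirac PUnit.unit))
  | t + 1 => by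
    have := isProbabilityMeasure_ctxLawGiven z t
    have h : IsProbabilityMeasure (D.promptLawGiven z t (M.H - 1)) := by
      rw [promptLawGiven_eq]; infer_instance
    exact h

instance (z : Z) (t k : ℕ) : IsProbabilityMeasure (D.promptLawGiven z t k) := by
  rw [promptLawGiven_eq]; infer_instance

/-- Given `z`, the current episode is independent of the context. This product form is what lets the
likelihood ratios factor. -/
lemma promptLawGiven_eq_map (z : Z) (t k : ℕ) :
    D.promptLawGiven z t k = ((D.ctxLawGiven z t).prod (D.episodeLaw z k)).map
      (MeasurableEquiv.prodAssoc (α := Ctx Ω O G M.H t) (β := Ω) (γ := Hist O G k)).symm := by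
  rw [promptLawGiven_eq, HMDP.traj_comap, prod_compProd_comap_snd, episodeLaw]

lemma hasDensityBound_prompt (z' z : Z) (t k : ℕ)
    (h : HasDensityBound (D.ctxLawGiven z' t) (D.ctxLawGiven z t) (D.ctxLik z' z t)) :
    HasDensityBound (D.promptLawGiven z' t k) (D.promptLawGiven z t k) (D.promptLik z' z t k) := by
  rw [promptLawGiven_eq_map, promptLawGiven_eq_map]
  exact HasDensityBound.map _ (by fun_prop)
    (h.prod (D.measurable_ctxLik z' z t) (D.measurable_lik z' z k) (hasDensityBound_rnDeriv _ _))

lemma ctxLawGiven_succ (z : Z) (t : ℕ) :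
    D.ctxLawGiven z (t + 1) = D.promptLawGiven z t (M.H - 1) := rfl

lemma ctxLik_succ (z' z : Z) (t : ℕ) :
    D.ctxLik z' z (t + 1) = D.promptLik z' z t (M.H - 1) := rfl

lemma hasDensityBound_ctx (z' z : Z) (t : ℕ) :
    HasDensityBound (D.ctxLawGiven z' t) (D.ctxLawGiven z t) (D.ctxLik z' z t) := by
  induction t with
  | zero =>
    obtain ⟨m, h0⟩ : ∃ m : Measure (Ctx Ω O G M.H 0), ∀ y, D.ctxLawGiven y 0 = m :=
      ⟨Measure.dirac (show Ctx Ω O G M.H 0 from PUnit.unit), fun _ => rfl⟩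
    have h1 : D.ctxLik z' z 0 = 1 := rfl
    refine ⟨∅, MeasurableSet.empty, measure_empty, ?_⟩
    rw [Set.compl_empty, Measure.restrict_univ, h0, h0, h1, withDensity_one]
  | succ t ih =>
    rw [ctxLawGiven_succ, ctxLawGiven_succ, ctxLik_succ]
    exact D.hasDensityBound_prompt z' z t (M.H - 1) ih

/-! ### Likelihood ratios under an arbitrary policy -/

section Deploy

variable {X : Type uC} [MeasurableSpace X]

/-- Under the behavior policy, the likelihood ratio of an episode remains a density bound when the
task is fixed. -/
lemma withDensity_lik_behavior_le (Γ : Measure X) [IsFiniteMeasure Γ] {ω : Ω}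
    (hω : Measure.dirac ω ≪ D.taskLaw) (z' z : Z) (k : ℕ) :
    ((Γ.prod (Measure.dirac ω)) ⊗ₘ
        M.traj M.emission z (D.behavior.comap Prod.snd measurable_snd) k).withDensity
          (fun x => D.lik z' z k (x.1.2, x.2))
      ≤ (Γ.prod (Measure.dirac ω)) ⊗ₘ
        M.traj M.emission z' (D.behavior.comap Prod.snd measurable_snd) k := by
  set u := (Measure.dirac ω).rnDeriv D.taskLaw with hu
  have hum : Measurable u := Measure.measurable_rnDeriv _ _
  -- The ratio `lik` is defined with a random task. A fixed task is reached by tilting with `u`,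
  -- which depends on the task alone and is the same for `z` and `z'`.
  have hdir : Measure.dirac ω = D.taskLaw.withDensity u :=
    (Measure.withDensity_rnDeriv_eq _ _ hω).symm
  have hdens : ∀ y, Measure.dirac ω ⊗ₘ M.traj M.emission y D.behavior k
      = (D.episodeLaw y k).withDensity (fun x => u x.1) := by
    intro y
    conv_lhs => rw [hdir]
    rw [Measure.withDensity_compProd _ _ hum, episodeLaw]
  have key : (Measure.dirac ω ⊗ₘ M.traj M.emission z D.behavior k).withDensity (D.lik z' z k)
      ≤ Measure.dirac ω ⊗ₘ M.traj M.emission z' D.behavior k := by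
    rw [hdens, hdens, ← withDensity_mul _ (by fun_prop) (by fun_prop), mul_comm,
      withDensity_mul _ (by fun_prop) (by fun_prop)]
    exact Measure.withDensity_mono_measure (Measure.withDensity_rnDeriv_le _ _) _
  have hfin : IsFiniteMeasure ((Measure.dirac ω ⊗ₘ M.traj M.emission z D.behavior k).withDensity
      (D.lik z' z k)) := isFiniteMeasure_of_le _ key
  rw [HMDP.traj_comap, HMDP.traj_comap, prod_compProd_comap_snd, prod_compProd_comap_snd,
    ← Measure.map_withDensity_comp _ (MeasurableEquiv.measurable _) (by fun_prop)]
  refine Measure.map_mono ?_ (MeasurableEquiv.measurable _)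
  refine le_trans (le_of_eq ?_) (Measure.prod_mono le_rfl key)
  exact (prod_withDensity_right (D.measurable_lik z' z k)).symm

/-- The likelihood ratio of an episode does not depend on the policy. -/
lemma withDensity_lik_le (Γ : Measure X) [IsFiniteMeasure Γ] {ω : Ω}
    (hω : Measure.dirac ω ≪ D.taskLaw) (z' z : Z) (k : ℕ) (q : Policy (X × Ω) O G)
    (hac : ∀ j < k, ((Γ.prod (Measure.dirac ω)) ⊗ₘ M.traj M.emission z q j) ⊗ₘ q.step j
      ≪ ((Γ.prod (Measure.dirac ω)) ⊗ₘ M.traj M.emission z q j)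
        ⊗ₘ (D.behavior.comap Prod.snd measurable_snd).step j) :
    ((Γ.prod (Measure.dirac ω)) ⊗ₘ M.traj M.emission z q k).withDensity
          (fun x => D.lik z' z k (x.1.2, x.2))
      ≤ (Γ.prod (Measure.dirac ω)) ⊗ₘ M.traj M.emission z' q k := by
  obtain ⟨W, hW, h1, h2⟩ := HMDP.exists_traj_eq_withDensity (M := M) (E := M.emission)
    (Γ.prod (Measure.dirac ω)) z z' q (D.behavior.comap Prod.snd measurable_snd) k hac
  -- The two tilts commute: first `lik` carries `z` below `z'` under the behavior policy, then `W`
  -- carries the behavior policy below `q` under `z'`.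
  rw [h1, ← withDensity_mul _ hW (by fun_prop), mul_comm, withDensity_mul _ (by fun_prop) hW]
  exact (Measure.withDensity_mono_measure (D.withDensity_lik_behavior_le Γ hω z' z k) W).trans h2

/-- A weight depending on the past is absorbed into the law of the past, so that one-episode
estimates can be chained. -/
lemma lintegral_weight {Γ : Measure X} [IsFiniteMeasure Γ] {ω : Ω} {k : ℕ}
    (κ : Kernel (X × Ω) (Hist O G k)) [IsMarkovKernel κ] {φ : X → ℝ≥0∞} (hφ : Measurable φ)
    [IsFiniteMeasure (Γ.withDensity φ)]
    {g : (X × Ω) × Hist O G k → ℝ≥0∞} (hg : Measurable g) :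
    ∫⁻ x, φ x.1.1 * g x ∂((Γ.prod (Measure.dirac ω)) ⊗ₘ κ)
      = ∫⁻ x, g x ∂(((Γ.withDensity φ).prod (Measure.dirac ω)) ⊗ₘ κ) := by
  rw [prod_withDensity_left hφ, Measure.withDensity_compProd _ _ (by fun_prop),
    lintegral_withDensity_eq_lintegral_mul _ (by fun_prop) hg]
  rfl

lemma ac_weight {Γ Γ' : Measure X} [IsFiniteMeasure Γ] [IsFiniteMeasure Γ'] (h : Γ' ≪ Γ) {ω : Ω}
    {z : Z} {j : ℕ} {q b : Policy (X × Ω) O G}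
    (hac : ((Γ.prod (Measure.dirac ω)) ⊗ₘ M.traj M.emission z q j) ⊗ₘ q.step j
      ≪ ((Γ.prod (Measure.dirac ω)) ⊗ₘ M.traj M.emission z q j) ⊗ₘ b.step j) :
    ((Γ'.prod (Measure.dirac ω)) ⊗ₘ M.traj M.emission z q j) ⊗ₘ q.step j
      ≪ ((Γ'.prod (Measure.dirac ω)) ⊗ₘ M.traj M.emission z q j) ⊗ₘ b.step j := by
  have h1 : (Γ'.prod (Measure.dirac ω)) ⊗ₘ M.traj M.emission z q j
      ≪ (Γ.prod (Measure.dirac ω)) ⊗ₘ M.traj M.emission z q j :=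
    (h.prod Measure.AbsolutelyContinuous.rfl).compProd_left _
  exact Measure.absolutelyContinuous_compProd_of_compProd ((h1.compProd_left _).trans hac)

/-- The expected square root of the likelihood ratio does not increase in an episode. -/
lemma lintegral_sqrt_lik_le (Γ : Measure X) [IsFiniteMeasure Γ] {ω : Ω}
    (hω : Measure.dirac ω ≪ D.taskLaw) (z' z : Z) (k : ℕ) (q : Policy (X × Ω) O G)
    (hac : ∀ j < k, ((Γ.prod (Measure.dirac ω)) ⊗ₘ M.traj M.emission z q j) ⊗ₘ q.step j
      ≪ ((Γ.prod (Measure.dirac ω)) ⊗ₘ M.traj M.emission z q j)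
        ⊗ₘ (D.behavior.comap Prod.snd measurable_snd).step j)
    {φ : X → ℝ≥0∞} (hφ : Measurable φ) (hφi : ∫⁻ x, φ x ∂Γ ≠ ∞) :
    ∫⁻ x, φ x.1.1 * D.lik z' z k (x.1.2, x.2) ^ (1 / 2 : ℝ)
        ∂((Γ.prod (Measure.dirac ω)) ⊗ₘ M.traj M.emission z q k)
      ≤ ∫⁻ x, φ x ∂Γ := by
  have hfin : IsFiniteMeasure (Γ.withDensity φ) := isFiniteMeasure_withDensity hφi
  rw [lintegral_weight _ hφ (by fun_prop)]
  have h := lintegral_rpow_half_le (by fun_prop)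
    (D.withDensity_lik_le (Γ.withDensity φ) hω z' z k q
      fun j hj => ac_weight (withDensity_absolutelyContinuous _ _) (hac j hj))
  rw [Measure.compProd_apply_univ, Measure.compProd_apply_univ, ← two_mul,
    ENNReal.mul_le_mul_iff_right (by norm_num) (by norm_num)] at h
  refine h.trans (le_of_eq ?_)
  rw [← Set.univ_prod_univ, Measure.prod_prod, withDensity_apply _ MeasurableSet.univ]
  simp

/-- Exploration contracts the expected square root of the likelihood ratio. -/
lemma lintegral_sqrt_lik_explore_le (Γ : Measure X) [IsFiniteMeasure Γ] {ω : Ω}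
    (hω : Measure.dirac ω ≪ D.taskLaw) {z' z : Z} (k : ℕ) (q : Policy PUnit.{1} O G)
    (hac : ∀ j < k, ((Γ.prod (Measure.dirac ω)) ⊗ₘ M.traj M.emission z
          (q.comap (fun _ : X × Ω => PUnit.unit) measurable_const) j)
        ⊗ₘ (q.comap (fun _ : X × Ω => PUnit.unit) measurable_const).step j
      ≪ ((Γ.prod (Measure.dirac ω)) ⊗ₘ M.traj M.emission z
          (q.comap (fun _ : X × Ω => PUnit.unit) measurable_const) j)
        ⊗ₘ (D.behavior.comap Prod.snd measurable_snd).step j)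
    {φ : X → ℝ≥0∞} (hφ : Measurable φ) (hφi : ∫⁻ x, φ x ∂Γ ≠ ∞) :
    ∫⁻ x, φ x.1.1 * D.lik z' z k (x.1.2, x.2) ^ (1 / 2 : ℝ)
        ∂((Γ.prod (Measure.dirac ω)) ⊗ₘ M.traj M.emission z
          (q.comap (fun _ : X × Ω => PUnit.unit) measurable_const) k)
      ≤ (∫⁻ x, φ x ∂Γ) * ENNReal.ofReal (1 - hellingerSq
          (M.traj M.emission z q k PUnit.unit) (M.traj M.emission z' q k PUnit.unit)) := by
  have hfin : IsFiniteMeasure (Γ.withDensity φ) := isFiniteMeasure_withDensity hφi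
  rw [lintegral_weight _ hφ (by fun_prop)]
  have h := D.withDensity_lik_le (Γ.withDensity φ) hω z' z k
    (q.comap (fun _ : X × Ω => PUnit.unit) measurable_const)
      fun j hj => ac_weight (withDensity_absolutelyContinuous _ _) (hac j hj)
  -- The exploration policy ignores context and task, so its trajectory is independent of them and
  -- the affinity of one fixed pair of laws factors out.
  have hconst : ∀ y, M.traj M.emission y
      (q.comap (fun _ : X × Ω => PUnit.unit) measurable_const) k
      = Kernel.const _ (M.traj M.emission y q k PUnit.unit) := by
    intro y
    rw [HMDP.traj_comap]
    rfl
  rw [hconst, hconst, Measure.compProd_const, Measure.compProd_const] at h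
  rw [hconst, Measure.compProd_const]
  refine (lintegral_rpow_half_le_hellinger _ _ _ (by fun_prop) h).trans (le_of_eq ?_)
  congr 1
  rw [← Set.univ_prod_univ, Measure.prod_prod, withDensity_apply _ MeasurableSet.univ]
  simp

end Deploy

/-! ### Absolute continuity and the posterior -/

section Prompt

variable [Fintype Z]

instance (t k : ℕ) (z : Z) : IsFiniteMeasure (D.prior z • D.promptLawGiven z t k) :=
  Measure.smul_finite _ (D.prior.apply_ne_top z)

instance (t k : ℕ) : IsFiniteMeasure (D.promptLaw t k) := by
  unfold promptLaw; infer_instance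

lemma prior_smul_le_promptLaw (z : Z) (t k : ℕ) :
    D.prior z • D.promptLawGiven z t k ≤ D.promptLaw t k :=
  Measure.le_iff.2 fun s _ => by
    rw [promptLaw, Measure.finsetSum_apply]
    exact Finset.single_le_sum (f := fun z => (D.prior z • D.promptLawGiven z t k) s)
      (fun _ _ => zero_le) (Finset.mem_univ z)

/-- The behavior policy does not depend on `z`, so the subgoal kernel comes out of the mixture over
`z`. -/
lemma map_tail_promptLaw (t k : ℕ) :
    (D.promptLaw t (k + 1)).map (fun y => ((y.1, (histTail y.2).1), (histTail y.2).2))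
      = D.promptLaw t k ⊗ₘ (D.behavior.comap Prod.snd measurable_snd).step k := by
  have hm : Measurable fun y : Prompt Ω O G M.H t (k + 1) =>
    ((y.1, (histTail y.2).1), (histTail y.2).2) := by fun_prop
  have h : ∀ j, D.promptLaw t j = Measure.sum fun z => D.prior z • D.promptLawGiven z t j :=
    fun j => (Measure.sum_fintype _).symm
  rw [h, h, Measure.map_sum hm.aemeasurable, Measure.compProd_sum_left]
  congr 1
  funext z
  rw [Measure.map_smul, Measure.compProd_smul_left, promptLawGiven_eq, promptLawGiven_eq,
    HMDP.compProd_traj_succ_map]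

/-- Being in support one step later forces the subgoal chosen now to be one that the behavior policy
could choose. This supplies the hypothesis of the change of policy. -/
lemma step_ac {t k : ℕ} {γ : Measure (Ctx Ω O G M.H t × Ω)} [IsFiniteMeasure γ] {z : Z}
    {q : Policy (Ctx Ω O G M.H t × Ω) O G}
    (h : γ ⊗ₘ M.traj M.emission z q (k + 1) ≪ D.promptLaw t (k + 1)) :
    (γ ⊗ₘ M.traj M.emission z q k) ⊗ₘ q.step k
      ≪ (γ ⊗ₘ M.traj M.emission z q k)
        ⊗ₘ (D.behavior.comap Prod.snd measurable_snd).step k := by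
  have h1 := h.map (f := fun y => ((y.1, (histTail y.2).1), (histTail y.2).2)) (by fun_prop)
  rw [map_tail_promptLaw, HMDP.compProd_traj_succ_map] at h1
  exact Measure.absolutelyContinuous_compProd_of_compProd h1

lemma dirac_ac {t k : ℕ} {Γ : Measure (Ctx Ω O G M.H t)} [IsProbabilityMeasure Γ] {ω : Ω}
    {κ : Kernel (Ctx Ω O G M.H t × Ω) (Hist O G k)} [IsMarkovKernel κ]
    (h : (Γ.prod (Measure.dirac ω)) ⊗ₘ κ ≪ D.promptLaw t k) : Measure.dirac ω ≪ D.taskLaw := by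
  refine Measure.AbsolutelyContinuous.mk fun s hs h0 => ?_
  have hm : MeasurableSet {p : Prompt Ω O G M.H t k | p.1.2 ∈ s} :=
    (measurable_snd.comp measurable_fst) hs
  have hset : {p : Prompt Ω O G M.H t k | p.1.2 ∈ s} = (Set.univ ×ˢ s) ×ˢ Set.univ := by
    ext p; simp
  have hval : ∀ (Γ : Measure (Ctx Ω O G M.H t)) (ν : Measure Ω) [IsProbabilityMeasure Γ]
      [IsProbabilityMeasure ν] (κ : Kernel (Ctx Ω O G M.H t × Ω) (Hist O G k)) [IsMarkovKernel κ],
      ((Γ.prod ν) ⊗ₘ κ) {p : Prompt Ω O G M.H t k | p.1.2 ∈ s} = ν s := by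
    intro Γ ν _ _ κ _
    rw [hset, Measure.compProd_apply_prod (MeasurableSet.univ.prod hs) MeasurableSet.univ]
    simp [Measure.prod_prod]
  rw [← hval Γ _ κ]
  refine h ?_
  rw [promptLaw, Measure.finsetSum_apply]
  refine Finset.sum_eq_zero fun z _ => ?_
  rw [Measure.smul_apply, promptLawGiven_eq, hval, h0, smul_zero]

omit [Fintype Z] in
-- The support assumption of the theorem only refers to the mixture over latent variables, whereas
-- posterior odds are bounded almost surely under the true `z`. This lemma bridges the gap, by the
-- change of policy with `z' = z`.
lemma prompt_ac {t k : ℕ} {Γ : Measure (Ctx Ω O G M.H t)} [IsFiniteMeasure Γ] {ω : Ω} {z : Z}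
    (hΓ : Γ ≪ D.ctxLawGiven z t) (hω : Measure.dirac ω ≪ D.taskLaw)
    {q : Policy (Ctx Ω O G M.H t × Ω) O G}
    (hac : ∀ j < k, ((Γ.prod (Measure.dirac ω)) ⊗ₘ M.traj M.emission z q j) ⊗ₘ q.step j
      ≪ ((Γ.prod (Measure.dirac ω)) ⊗ₘ M.traj M.emission z q j)
        ⊗ₘ (D.behavior.comap Prod.snd measurable_snd).step j) :
    (Γ.prod (Measure.dirac ω)) ⊗ₘ M.traj M.emission z q k ≪ D.promptLawGiven z t k := by
  obtain ⟨W, hW, h1, -⟩ := HMDP.exists_traj_eq_withDensity (M := M) (E := M.emission)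
    (Γ.prod (Measure.dirac ω)) z z q (D.behavior.comap Prod.snd measurable_snd) k hac
  rw [h1, promptLawGiven_eq]
  exact (withDensity_absolutelyContinuous _ _).trans ((hΓ.prod hω).compProd_left _)

/-- Posterior probability of the latent variable `z` given the prompt. -/
def posterior (t k : ℕ) (z : Z) : Prompt Ω O G M.H t k → ℝ≥0∞ :=
  (D.prior z • D.promptLawGiven z t k).rnDeriv (D.promptLaw t k)

@[fun_prop]
lemma measurable_posterior (t k : ℕ) (z : Z) : Measurable (D.posterior t k z) :=
  Measure.measurable_rnDeriv _ _

lemma posterior_le_one (t k : ℕ) (z : Z) : ∀ᵐ p ∂(D.promptLaw t k), D.posterior t k z p ≤ 1 :=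
  Measure.rnDeriv_le_one_of_le (D.prior_smul_le_promptLaw z t k)

lemma one_sub_posterior_le [DecidableEq Z] (t k : ℕ) (z : Z) :
    ∀ᵐ p ∂(D.promptLaw t k),
      1 - D.posterior t k z p ≤ ∑ z' ∈ Finset.univ.erase z, D.posterior t k z' p := by
  have h := one_le_sum_rnDeriv fun z => D.prior z • D.promptLawGiven z t k
  filter_upwards [h] with p hp
  rw [tsub_le_iff_left, Finset.add_sum_erase _ (fun z => D.posterior t k z p) (Finset.mem_univ z)]
  exact hp

/-- A number at most `1` and at most `x` is at most `√x`. The square root is what makes the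
expectation under `z` an affinity. -/
lemma posterior_le_sqrt {c : ℝ≥0∞} (t k : ℕ) (z' z : Z) (hz : D.prior z ≠ 0)
    (hc : D.prior z' ≤ c * D.prior z) :
    ∀ᵐ p ∂(D.promptLawGiven z t k),
      D.posterior t k z' p ≤ c ^ (1 / 2 : ℝ) * D.promptLik z' z t k p ^ (1 / 2 : ℝ) := by
  have hac : D.promptLawGiven z t k ≪ D.promptLaw t k :=
    (Measure.absolutelyContinuous_smul hz).trans
      (Measure.absolutelyContinuous_of_le (D.prior_smul_le_promptLaw z t k))
  have h := (D.hasDensityBound_prompt z' z t k (D.hasDensityBound_ctx z' z t)).rnDeriv_le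
    (D.prior_smul_le_promptLaw z t k) (D.prior_smul_le_promptLaw z' t k) hz hc (by fun_prop)
  filter_upwards [h, hac.ae_le (D.posterior_le_one t k z')] with p hp hp1
  rw [← ENNReal.mul_rpow_of_nonneg _ _ (by norm_num)]
  calc D.posterior t k z' p
      = D.posterior t k z' p ^ (1 / 2 : ℝ) * D.posterior t k z' p ^ (1 / 2 : ℝ) :=
        (ENNReal_rpow_half_mul_self _).symm
    _ ≤ (c * D.promptLik z' z t k p) ^ (1 / 2 : ℝ) * 1 :=
        mul_le_mul' (ENNReal.rpow_le_rpow hp (by norm_num))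
          (ENNReal.rpow_le_one hp1 (by norm_num))
    _ = _ := mul_one _

/-- Bayes' rule: the prior-weighted laws of the prompt become posterior weights on one common law of
the prompt. -/
lemma promptLabelLaw_eq (t k : ℕ) :
    D.promptLabelLaw t k = ∑ z, (D.promptLaw t k ⊗ₘ
      ((D.expert z).comap Prod.snd measurable_snd).step k).withDensity
        (fun x => D.posterior t k z x.1) := by
  unfold promptLabelLaw
  refine Finset.sum_congr rfl fun z _ => ?_
  rw [← Measure.withDensity_compProd _ _ (by fun_prop), posterior,
    Measure.withDensity_rnDeriv_eq _ _
      (Measure.absolutelyContinuous_of_le (D.prior_smul_le_promptLaw z t k)),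
    Measure.compProd_smul_left]

end Prompt

end Pretraining

end PAR

end

/-! ### Rewards, the planner and the regret of one episode -/

noncomputable section

namespace PAR

universe uS uA uO uG uW uZ uC uD

variable {S : Type uS} {A : Type uA} {O : Type uO} {G : Type uG} {Ω : Type uW} {Z : Type uZ}
  [MeasurableSpace S] [MeasurableSpace A] [MeasurableSpace O] [MeasurableSpace G]
  [MeasurableSpace Ω]

namespace HMDP

variable (M : HMDP S A O G Ω Z)

lemma measurable_pastReward (ω : Ω) : ∀ k, Measurable (M.pastReward (G := G) ω k)
  | 0 => measurable_const
  | k + 1 => by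
    have h := measurable_pastReward ω k
    have hr := M.reward_measurable k ω
    have : Measurable fun p : (Past O G k × O) × G =>
      M.pastReward ω k p.1.1 + M.reward k p.1.2 ω := by fun_prop
    exact this

@[fun_prop]
lemma measurable_totalReward (ω : Ω) : Measurable (M.totalReward (G := G) ω) := by
  have h := M.measurable_pastReward (G := G) ω (M.H - 1)
  have hr := M.reward_measurable (M.H - 1) ω
  unfold totalReward
  fun_prop

lemma pastReward_mem (ω : Ω) : ∀ k (p : Past O G k), M.pastReward ω k p ∈ Set.Icc (0 : ℝ) k
  | 0, _ => by simp [pastReward]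
  | k + 1, p => by
    have h := pastReward_mem ω k p.1.1
    have hr := M.reward_mem k p.1.2 ω
    simp only [pastReward, Set.mem_Icc] at *
    push_cast
    constructor <;> linarith [h.1, h.2, hr.1, hr.2]

lemma totalReward_mem (ω : Ω) (τ : Hist O G (M.H - 1)) :
    M.totalReward ω τ ∈ Set.Icc (0 : ℝ) M.H := by
  have h := M.pastReward_mem ω (M.H - 1) τ.1
  have hr := M.reward_mem (M.H - 1) τ.2 ω
  have hH : ((M.H - 1 : ℕ) : ℝ) = M.H - 1 := by
    rw [Nat.cast_sub M.H_pos]; simp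
  rw [hH] at h
  simp only [totalReward, Set.mem_Icc] at *
  constructor <;> linarith [h.1, h.2, hr.1, hr.2]

lemma expectedReturn_eq_lintegral (ω : Ω) (μ : Measure (Hist O G (M.H - 1))) :
    M.expectedReturn ω μ = (∫⁻ τ, ENNReal.ofReal (M.totalReward ω τ) ∂μ).toReal :=
  integral_eq_lintegral_of_nonneg_ae (ae_of_all _ fun τ => (M.totalReward_mem ω τ).1)
    (M.measurable_totalReward ω).aestronglyMeasurable

lemma lintegral_totalReward_le {X : Type*} [MeasurableSpace X] (ω : Ω)
    (μ : Measure (X × Hist O G (M.H - 1))) [IsProbabilityMeasure μ] :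
    ∫⁻ x, ENNReal.ofReal (M.totalReward ω x.2) ∂μ ≤ M.H := by
  calc ∫⁻ x, ENNReal.ofReal (M.totalReward ω x.2) ∂μ ≤ ∫⁻ _, (M.H : ℝ≥0∞) ∂μ := by
        refine lintegral_mono fun x => ?_
        rw [← ENNReal.ofReal_natCast]
        exact ENNReal.ofReal_le_ofReal (M.totalReward_mem ω x.2).2
    _ = M.H := by simp

lemma integral_expectedReturn {X : Type*} [MeasurableSpace X] (Γ : Measure X)
    [IsProbabilityMeasure Γ] (ω : Ω) (κ : Kernel (X × Ω) (Hist O G (M.H - 1))) [IsMarkovKernel κ]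
    (V : ℝ) :
    ∫ c, (V - M.expectedReturn ω (κ (c, ω))) ∂Γ
      = V - (∫⁻ x, ENNReal.ofReal (M.totalReward ω x.2)
          ∂((Γ.prod (Measure.dirac ω)) ⊗ₘ κ)).toReal := by
  set F : X × Ω → ℝ≥0∞ := fun c => ∫⁻ τ, ENNReal.ofReal (M.totalReward ω τ) ∂(κ c) with hF
  have hRm : Measurable fun τ : Hist O G (M.H - 1) => ENNReal.ofReal (M.totalReward ω τ) := by
    fun_prop
  have hFm : Measurable F := hRm.lintegral_kernel
  have hFle : ∀ c, F c ≤ M.H := fun c => by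
    calc F c ≤ ∫⁻ _, (M.H : ℝ≥0∞) ∂(κ c) := by
          refine lintegral_mono fun τ => ?_
          rw [← ENNReal.ofReal_natCast]
          exact ENNReal.ofReal_le_ofReal (M.totalReward_mem ω τ).2
      _ = M.H := by simp
  have hFtop : ∀ c, F c < ∞ := fun c => (hFle c).trans_lt (ENNReal.natCast_lt_top _)
  have hF' : Measurable fun c : X => F (c, ω) := hFm.comp measurable_prodMk_right
  have hint : ∫⁻ x, ENNReal.ofReal (M.totalReward ω x.2) ∂((Γ.prod (Measure.dirac ω)) ⊗ₘ κ)
      = ∫⁻ c, F (c, ω) ∂Γ := by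
    rw [Measure.lintegral_compProd (by fun_prop), lintegral_prod _ hFm.aemeasurable]
    refine lintegral_congr fun c => ?_
    exact lintegral_dirac' _ (hFm.comp measurable_prodMk_left)
  have hi : Integrable (fun c => (F (c, ω)).toReal) Γ := by
    refine integrable_toReal_of_lintegral_ne_top hF'.aemeasurable ?_
    refine ne_top_of_le_ne_top (ENNReal.natCast_ne_top M.H) ?_
    calc ∫⁻ c, F (c, ω) ∂Γ ≤ ∫⁻ _, (M.H : ℝ≥0∞) ∂Γ := lintegral_mono fun c => hFle _
      _ = M.H := by simp
  have he : ∀ c, M.expectedReturn ω (κ (c, ω)) = (F (c, ω)).toReal := fun c =>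
    M.expectedReturn_eq_lintegral ω _
  simp only [he]
  rw [integral_sub (integrable_const _) hi, hint,
    integral_toReal hF'.aemeasurable (ae_of_all _ fun c => hFtop _)]
  simp

end HMDP

namespace System

variable {M : HMDP S A O G Ω Z} (P : System M) (E : Kernel S O) [IsMarkovKernel E]
  (z : Z) (explore : Policy PUnit.{1} O G) (ε : ℝ)

instance (t k : ℕ) : IsFiniteKernel (P.planner E z explore ε t k) :=
  ⟨ENNReal.ofReal ε + ENNReal.ofReal (1 - ε), by simp, fun c => by
    change (ENNReal.ofReal ε • M.traj E z explore k PUnit.unit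
      + ENNReal.ofReal (1 - ε) • M.traj E z (P.llm t) k c) Set.univ ≤ _
    simp⟩

variable {ε}

lemma isMarkovKernel_planner (h0 : 0 ≤ ε) (h1 : ε ≤ 1) (t k : ℕ) :
    IsMarkovKernel (P.planner E z explore ε t k) :=
  ⟨fun c => ⟨by
    change (ENNReal.ofReal ε • M.traj E z explore k PUnit.unit
      + ENNReal.ofReal (1 - ε) • M.traj E z (P.llm t) k c) Set.univ = 1
    simp [← ENNReal.ofReal_add h0 (sub_nonneg.2 h1)]⟩⟩

variable (ε)

/-- The exploration policy, as a policy that ignores the context. -/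
abbrev exploreCtx (X : Type*) [MeasurableSpace X] : Policy X O G :=
  explore.comap (fun _ => PUnit.unit) measurable_const

/-- The exploration coin is tossed once per episode, so the whole trajectory law, and not each step,
is a mixture. -/
lemma compProd_planner (t k : ℕ) (γ : Measure (Ctx Ω O G M.H t × Ω)) [IsFiniteMeasure γ] :
    γ ⊗ₘ P.planner E z explore ε t k
      = ENNReal.ofReal ε • (γ ⊗ₘ M.traj E z (exploreCtx explore _) k)
        + ENNReal.ofReal (1 - ε) • (γ ⊗ₘ M.traj E z (P.llm t) k) := by
  refine Measure.ext_of_lintegral _ fun f hf => ?_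
  have hm : ∀ q : Policy (Ctx Ω O G M.H t × Ω) O G,
      Measurable fun c => ∫⁻ τ, f (c, τ) ∂(M.traj E z q k c) := fun q =>
    Measurable.lintegral_kernel_prod_right' hf
  rw [lintegral_add_measure, lintegral_smul_measure, lintegral_smul_measure,
    Measure.lintegral_compProd hf, Measure.lintegral_compProd hf, Measure.lintegral_compProd hf,
    smul_eq_mul, smul_eq_mul, ← lintegral_const_mul _ (hm _), ← lintegral_const_mul _ (hm _),
    ← lintegral_add_left ((hm _).const_mul _)]
  refine lintegral_congr fun c => ?_
  rw [HMDP.traj_comap]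
  change ∫⁻ τ, f (c, τ) ∂(ENNReal.ofReal ε • M.traj E z explore k PUnit.unit
      + ENNReal.ofReal (1 - ε) • M.traj E z (P.llm t) k c) = _
  rw [lintegral_add_measure, lintegral_smul_measure, lintegral_smul_measure]
  rfl

variable (w : ℕ → Ω)

lemma deployContextLaw_succ (t : ℕ) :
    P.deployContextLaw z explore ε w (t + 1)
      = (P.deployContextLaw z explore ε w t).prod (Measure.dirac (w t))
        ⊗ₘ P.planner P.reporter z explore ε t (M.H - 1) := rfl

lemma deployPromptLaw_eq (t k : ℕ) :
    P.deployPromptLaw z explore ε w t k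
      = (P.deployContextLaw z explore ε w t).prod (Measure.dirac (w t))
        ⊗ₘ P.planner P.reporter z explore ε t k := rfl

variable {ε}

lemma isProbabilityMeasure_deployContextLaw (h0 : 0 ≤ ε) (h1 : ε ≤ 1) (t : ℕ) :
    IsProbabilityMeasure (P.deployContextLaw z explore ε w t) := by
  induction t with
  | zero => exact inferInstanceAs (IsProbabilityMeasure (Measure.dirac PUnit.unit))
  | succ t ih =>
    have h := P.isMarkovKernel_planner P.reporter z explore h0 h1 t (M.H - 1)
    have : IsProbabilityMeasure ((P.deployContextLaw z explore ε w t).prod (Measure.dirac (w t))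
        ⊗ₘ P.planner P.reporter z explore ε t (M.H - 1)) := inferInstance
    exact this

section Deploy

variable [Fintype Z] {D : Pretraining M} {P z explore w} {t : ℕ}

lemma explore_ac (hE : P.reporter = M.emission) (h0 : 0 < ε) (h1 : ε ≤ 1) {k : ℕ}
    (hac : P.deployPromptLaw z explore ε w t k ≪ D.promptLaw t k) :
    (P.deployContextLaw z explore ε w t).prod (Measure.dirac (w t))
      ⊗ₘ M.traj M.emission z (exploreCtx explore _) k ≪ D.promptLaw t k := by
  have := P.isProbabilityMeasure_deployContextLaw z explore w h0.le h1 t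
  rw [deployPromptLaw_eq, compProd_planner, hE] at hac
  exact (Measure.absolutelyContinuous_smul (by simpa using h0)).trans
    ((Measure.absolutelyContinuous_of_le (Measure.le_add_right le_rfl)).trans hac)

lemma llm_ac (hE : P.reporter = M.emission) (h0 : 0 ≤ ε) (h1 : ε < 1) {k : ℕ}
    (hac : P.deployPromptLaw z explore ε w t k ≪ D.promptLaw t k) :
    (P.deployContextLaw z explore ε w t).prod (Measure.dirac (w t))
      ⊗ₘ M.traj M.emission z (P.llm t) k ≪ D.promptLaw t k := by
  have := P.isProbabilityMeasure_deployContextLaw z explore w h0 h1.le t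
  rw [deployPromptLaw_eq, compProd_planner, hE] at hac
  exact (Measure.absolutelyContinuous_smul (by simpa using h1)).trans
    ((Measure.absolutelyContinuous_of_le (Measure.le_add_left le_rfl)).trans hac)

/-- Along the deployment, the context law stays absolutely continuous with respect to its
pretraining law given `z`, and the expected square roots of the likelihood ratios decay. -/
lemma ctx_invariants (hE : P.reporter = M.emission) (h0 : 0 < ε) (h1 : ε < 1) {η : ℝ}
    (hdist : Distinguishable M explore η) (t : ℕ)
    (hac : ∀ i < t, ∀ k < M.H, P.deployPromptLaw z explore ε w i k ≪ D.promptLaw i k) :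
    P.deployContextLaw z explore ε w t ≪ D.ctxLawGiven z t ∧
      ∀ z' ≠ z, ∫⁻ c, D.ctxLik z' z t c ^ (1 / 2 : ℝ) ∂(P.deployContextLaw z explore ε w t)
        ≤ ENNReal.ofReal (1 - ε * η) ^ t := by
  induction t with
  | zero =>
    obtain ⟨m, hm, hm', hp⟩ : ∃ m : Measure (Ctx Ω O G M.H 0),
        P.deployContextLaw z explore ε w 0 = m ∧ D.ctxLawGiven z 0 = m ∧ m Set.univ = 1 :=
      ⟨Measure.dirac (show Ctx Ω O G M.H 0 from PUnit.unit), rfl, rfl, measure_univ⟩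
    refine ⟨by rw [hm, hm'], fun z' _ => ?_⟩
    have h1 : D.ctxLik z' z 0 = 1 := rfl
    simp [hm, h1, hp]
  | succ t ih =>
    obtain ⟨hΓ, hlik⟩ := ih fun i hi => hac i (by omega)
    have hprob := P.isProbabilityMeasure_deployContextLaw z explore w h0.le h1.le t
    have hH := M.H_pos
    have hacE : ∀ k < M.H, _ := fun k hk => explore_ac hE h0 h1.le (hac t (by omega) k hk)
    have hacL : ∀ k < M.H, _ := fun k hk => llm_ac hE h0.le h1 (hac t (by omega) k hk)
    have hω := D.dirac_ac (hacE 0 hH)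
    have hsE : ∀ j < M.H - 1, _ := fun j hj => D.step_ac (hacE (j + 1) (by omega))
    have hsL : ∀ j < M.H - 1, _ := fun j hj => D.step_ac (hacL (j + 1) (by omega))
    have hdec := P.compProd_planner M.emission z explore ε t (M.H - 1)
      ((P.deployContextLaw z explore ε w t).prod (Measure.dirac (w t)))
    rw [← hE, ← deployContextLaw_succ, hE] at hdec
    refine ⟨?_, fun z' hz' => ?_⟩
    -- Both components of the planner stay absolutely continuous with respect to the law given `z`,
    -- hence so does their mixture.
    · rw [hdec, D.ctxLawGiven_succ]
      exact Measure.AbsolutelyContinuous.add_left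
        ((D.prompt_ac hΓ hω hsE).smul_left _) ((D.prompt_ac hΓ hω hsL).smul_left _)
    · have hφ : Measurable fun c => D.ctxLik z' z t c ^ (1 / 2 : ℝ) := by fun_prop
      have hφi : ∫⁻ c, D.ctxLik z' z t c ^ (1 / 2 : ℝ) ∂(P.deployContextLaw z explore ε w t) ≠ ∞ :=
        ne_top_of_le_ne_top (ENNReal.pow_ne_top ENNReal.ofReal_ne_top) (hlik z' hz')
      have hL := D.lintegral_sqrt_lik_le _ hω z' z (M.H - 1) (P.llm t) hsL hφ hφi
      have hX := D.lintegral_sqrt_lik_explore_le _ hω (z' := z') (M.H - 1) explore hsE hφ hφi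
      have hη : η ≤ _ := hdist z z' hz'.symm
      have hη1 : η ≤ 1 := hη.trans (hellingerSq_le_one _ _)
      have hsplit : ∀ p : Prompt Ω O G M.H t (M.H - 1),
          D.promptLik z' z t (M.H - 1) p ^ (1 / 2 : ℝ) = D.ctxLik z' z t p.1.1 ^ (1 / 2 : ℝ)
            * D.lik z' z (M.H - 1) (p.1.2, p.2) ^ (1 / 2 : ℝ) := fun p => by
        rw [Pretraining.promptLik, ENNReal.mul_rpow_of_nonneg _ _ (by norm_num)]
      rw [D.ctxLik_succ, hdec]
      suffices h : ∫⁻ p : Prompt Ω O G M.H t (M.H - 1),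
          D.promptLik z' z t (M.H - 1) p ^ (1 / 2 : ℝ) ∂(ENNReal.ofReal ε •
            ((P.deployContextLaw z explore ε w t).prod (Measure.dirac (w t))
              ⊗ₘ M.traj M.emission z (exploreCtx explore _) (M.H - 1))
            + ENNReal.ofReal (1 - ε) •
            ((P.deployContextLaw z explore ε w t).prod (Measure.dirac (w t))
              ⊗ₘ M.traj M.emission z (P.llm t) (M.H - 1)))
          ≤ ENNReal.ofReal (1 - ε * η) ^ (t + 1) from h
      rw [lintegral_add_measure, lintegral_smul_measure, lintegral_smul_measure]
      simp only [hsplit, smul_eq_mul]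
      refine (add_le_add (mul_le_mul' le_rfl hX) (mul_le_mul' le_rfl hL)).trans ?_
      rw [pow_succ]
      set m := ∫⁻ c, D.ctxLik z' z t c ^ (1 / 2 : ℝ) ∂(P.deployContextLaw z explore ε w t)
      -- Exploration contributes the factor `1 - η`, the LLM the factor `1`; the mixture gives `ε (1
      -- - η) + (1 - ε) = 1 - ε η`.
      calc _ ≤ ENNReal.ofReal ε * (m * ENNReal.ofReal (1 - η)) + ENNReal.ofReal (1 - ε) * m := by
            gcongr
        _ = m * (ENNReal.ofReal ε * ENNReal.ofReal (1 - η) + ENNReal.ofReal (1 - ε)) := by ring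
        _ = m * ENNReal.ofReal (1 - ε * η) := by
            rw [← ENNReal.ofReal_mul h0.le, ← ENNReal.ofReal_add
              (mul_nonneg h0.le (by linarith)) (by linarith)]
            congr 2; ring
        _ ≤ _ := by gcongr; exact hlik z' hz'

/-- The completed episodes give the decay. The unfinished current episode is played by the LLM and
cannot increase the mean square root. -/
lemma lintegral_posterior_le (hE : P.reporter = M.emission) (h0 : 0 < ε) (h1 : ε < 1) {η : ℝ}
    (hdist : Distinguishable M explore η)
    (hac : ∀ i ≤ t, ∀ k < M.H, P.deployPromptLaw z explore ε w i k ≪ D.promptLaw i k)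
    {c : ℝ≥0∞} {z' : Z} (hz' : z' ≠ z) (hz : D.prior z ≠ 0) (hc : D.prior z' ≤ c * D.prior z)
    {k : ℕ} (hk : k < M.H) :
    ∫⁻ p, D.posterior t k z' p ∂((P.deployContextLaw z explore ε w t).prod (Measure.dirac (w t))
        ⊗ₘ M.traj M.emission z (P.llm t) k)
      ≤ c ^ (1 / 2 : ℝ) * ENNReal.ofReal (1 - ε * η) ^ t := by
  obtain ⟨hΓ, hlik⟩ := ctx_invariants (D := D) (z := z) (w := w) hE h0 h1 hdist t
    fun i hi => hac i hi.le
  have hprob := P.isProbabilityMeasure_deployContextLaw z explore w h0.le h1.le t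
  have hacL : ∀ k < M.H, _ := fun k hk => llm_ac hE h0.le h1 (hac t le_rfl k hk)
  have hω := D.dirac_ac (hacL k hk)
  have hsL : ∀ j < k, _ := fun j hj => D.step_ac (hacL (j + 1) (by omega))
  have hφ : Measurable fun c => D.ctxLik z' z t c ^ (1 / 2 : ℝ) := by fun_prop
  have hφi : ∫⁻ c, D.ctxLik z' z t c ^ (1 / 2 : ℝ) ∂(P.deployContextLaw z explore ε w t) ≠ ∞ :=
    ne_top_of_le_ne_top (ENNReal.pow_ne_top ENNReal.ofReal_ne_top) (hlik z' hz')
  have hL := D.lintegral_sqrt_lik_le _ hω z' z k (P.llm t) hsL hφ hφi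
  have hQ := D.prompt_ac hΓ hω hsL
  refine (lintegral_mono_ae (hQ.ae_le (D.posterior_le_sqrt t k z' z hz hc))).trans ?_
  rw [lintegral_const_mul _ (by fun_prop)]
  gcongr
  refine le_trans (le_of_eq (lintegral_congr fun p => ?_)) (hL.trans (hlik z' hz'))
  rw [Pretraining.promptLik, ENNReal.mul_rpow_of_nonneg _ _ (by norm_num)]

/-- The part of the LLM's distribution due to the true latent variable. -/
lemma posterior_joint_le (hperf : P.PerfectlyPretrained D) (ht : t < D.Tp) {k : ℕ} (hk : k < M.H)
    {γ : Measure (Ctx Ω O G M.H t × Ω)} [IsFiniteMeasure γ]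
    (hac : γ ⊗ₘ M.traj M.emission z (P.llm t) k ≪ D.promptLaw t k) :
    ((M.joint γ M.emission z (P.llm t) k).withDensity
        (fun y => min 1 (D.posterior t k z (y.1, y.2.1))))
        ⊗ₘ HMDP.stepState ((D.expert z).comap Prod.snd measurable_snd) k
      ≤ M.joint γ M.emission z (P.llm t) k ⊗ₘ HMDP.stepState (P.llm t) k := by
  have hp : Measurable fun y : (Ctx Ω O G M.H t × Ω) × (Hist O G k × S) => (y.1, y.2.1) := by
    fun_prop
  have h := hperf.llm_eq t ht k hk
  rw [D.promptLabelLaw_eq] at h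
  -- The LLM's mixture identity is known on the law of prompts; it is transferred to the deployment
  -- law with the hidden state. All terms but that of `z` are then dropped.
  have h2 := Measure.compProd_comap_eq_sum (μ := D.promptLaw t k) (κ := (P.llm t).step k)
    (η := fun z => ((D.expert z).comap Prod.snd measurable_snd).step k)
    (v := fun z x => D.posterior t k z x.1) (fun z => by fun_prop) h.symm
    (ν := M.joint γ M.emission z (P.llm t) k) hp (by rwa [← HMDP.compProd_traj])
  refine le_trans ?_ h2.symm.le
  rw [Measure.withDensity_compProd _ _ (by fun_prop)]
  refine (withDensity_mono (ae_of_all _ fun y => min_le_right _ _)).trans ?_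
  refine Measure.le_iff.2 fun s _ => ?_
  rw [Measure.finsetSum_apply]
  exact Finset.single_le_sum (f := fun z' => ((M.joint γ M.emission z (P.llm t) k
    ⊗ₘ (((D.expert z').comap Prod.snd measurable_snd).step k).comap
      (fun y => (y.1, y.2.1)) hp).withDensity
        (fun y => D.posterior t k z' (y.1.1, y.1.2.1))) s)
    (fun _ _ => zero_le) (Finset.mem_univ z)

omit [Fintype Z] in
-- The expert ignores the context, so its value may be averaged over any context law. This puts
-- expert and LLM over the same initial measure.
lemma value_eq (z : Z) (ω : Ω) (Γ : Measure (Ctx Ω O G M.H t)) [IsProbabilityMeasure Γ]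
    (π : Policy Ω O G) :
    M.value z π ω = (∫⁻ x, ENNReal.ofReal (M.totalReward ω x.2) ∂((Γ.prod (Measure.dirac ω))
      ⊗ₘ M.traj M.emission z (π.comap Prod.snd measurable_snd) (M.H - 1))).toReal := by
  have h := M.integral_expectedReturn Γ ω
    (M.traj M.emission z (π.comap Prod.snd measurable_snd) (M.H - 1)) 0
  have h2 : ∀ c : Ctx Ω O G M.H t, M.expectedReturn ω
      (M.traj M.emission z (π.comap Prod.snd measurable_snd) (M.H - 1) (c, ω))
      = M.value z π ω := fun c => by rw [HMDP.traj_comap]; rfl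
  simp only [h2, zero_sub, integral_const, probReal_univ, smul_eq_mul, one_mul] at h
  linarith

omit [Fintype Z] in
lemma value_le (z : Z) (ω : Ω) (π : Policy Ω O G) : M.value z π ω ≤ M.H := by
  rw [HMDP.value, HMDP.expectedReturn_eq_lintegral]
  refine ENNReal.toReal_le_of_le_ofReal (Nat.cast_nonneg _) ?_
  calc _ ≤ ∫⁻ _, (M.H : ℝ≥0∞) ∂(M.traj M.emission z π (M.H - 1) ω) := by
        refine lintegral_mono fun x => ?_
        rw [← ENNReal.ofReal_natCast]
        exact ENNReal.ofReal_le_ofReal (M.totalReward_mem ω x).2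
    _ = ENNReal.ofReal M.H := by simp

omit [Fintype Z] in
/-- The regret of one episode is at most the horizon. -/
lemma episode_regret_le_horizon (h0 : 0 ≤ ε) (h1 : ε ≤ 1) (π : Policy Ω O G) :
    ∫ c, (M.value z π (w t)
      - M.expectedReturn (w t) (P.planner M.emission z explore ε t (M.H - 1) (c, w t)))
      ∂(P.deployContextLaw z explore ε w t) ≤ M.H := by
  have hprob := P.isProbabilityMeasure_deployContextLaw z explore w h0 h1 t
  have hM := P.isMarkovKernel_planner M.emission z explore h0 h1 t (M.H - 1)
  rw [M.integral_expectedReturn]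
  have := value_le (M := M) z (w t) π
  linarith [ENNReal.toReal_nonneg (a := ∫⁻ x, ENNReal.ofReal (M.totalReward (w t) x.2)
    ∂((P.deployContextLaw z explore ε w t).prod (Measure.dirac (w t))
      ⊗ₘ P.planner M.emission z explore ε t (M.H - 1)))]

/-- The regret of one episode, in terms of the posterior mass of the wrong latent variables. -/
lemma episode_regret_le (h0 : 0 ≤ ε) (h1 : ε ≤ 1) (hperf : P.PerfectlyPretrained D)
    (ht : t < D.Tp)
    (hac : ∀ k < M.H, (P.deployContextLaw z explore ε w t).prod (Measure.dirac (w t))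
      ⊗ₘ M.traj M.emission z (P.llm t) k ≪ D.promptLaw t k)
    {β : ℝ} (hβ0 : 0 ≤ β)
    (hβ : ∀ k < M.H, ∀ z' ≠ z, ∫⁻ p, D.posterior t k z' p
      ∂((P.deployContextLaw z explore ε w t).prod (Measure.dirac (w t))
        ⊗ₘ M.traj M.emission z (P.llm t) k) ≤ ENNReal.ofReal β) :
    ∫ c, (M.value z (D.expert z) (w t)
      - M.expectedReturn (w t) (P.planner M.emission z explore ε t (M.H - 1) (c, w t)))
      ∂(P.deployContextLaw z explore ε w t)
      ≤ ε * M.H + M.H ^ 2 * ((Fintype.card Z - 1 : ℕ) * β) := by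
  classical
  have hprob := P.isProbabilityMeasure_deployContextLaw z explore w h0 h1 t
  have hM := P.isMarkovKernel_planner M.emission z explore h0 h1 t (M.H - 1)
  have hH := M.H_pos
  have hV := value_le (M := M) z (w t) (D.expert z)
  rw [M.integral_expectedReturn, compProd_planner, lintegral_add_measure, lintegral_smul_measure,
    lintegral_smul_measure]
  have hVe := value_eq z (w t) (P.deployContextLaw z explore ε w t) (D.expert z)
  set γ := (P.deployContextLaw z explore ε w t).prod (Measure.dirac (w t)) with hγ
  have hXE := M.lintegral_totalReward_le (w t)
    (γ ⊗ₘ M.traj M.emission z (exploreCtx explore _) (M.H - 1))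
  have hXL := M.lintegral_totalReward_le (w t)
    (γ ⊗ₘ M.traj M.emission z (P.llm t) (M.H - 1))
  have hwrong : ∀ k < M.H, ∫⁻ p, (1 - min 1 (D.posterior t k z p))
      ∂(γ ⊗ₘ M.traj M.emission z (P.llm t) k)
        ≤ ENNReal.ofReal ((Fintype.card Z - 1 : ℕ) * β) := by
    intro k hk
    calc _ ≤ ∫⁻ p, ∑ z' ∈ Finset.univ.erase z, D.posterior t k z' p
          ∂(γ ⊗ₘ M.traj M.emission z (P.llm t) k) := by
          refine lintegral_mono_ae ((hac k hk).ae_le ?_)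
          filter_upwards [D.one_sub_posterior_le t k z] with p hp
          refine le_trans (le_of_eq ?_) hp
          rcases le_total 1 (D.posterior t k z p) with h | h
          · rw [min_eq_left h, tsub_self, tsub_eq_zero_of_le h]
          · rw [min_eq_right h]
      _ = ∑ z' ∈ Finset.univ.erase z, ∫⁻ p, D.posterior t k z' p
          ∂(γ ⊗ₘ M.traj M.emission z (P.llm t) k) :=
          lintegral_finsetSum _ fun z' _ => by fun_prop
      _ ≤ ∑ z' ∈ Finset.univ.erase z, ENNReal.ofReal β :=
          Finset.sum_le_sum fun z' hz' => hβ k hk z' (Finset.ne_of_mem_erase hz')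
      _ = _ := by
          rw [Finset.sum_const, Finset.card_erase_of_mem (Finset.mem_univ z), Finset.card_univ,
            nsmul_eq_mul, ENNReal.ofReal_mul (Nat.cast_nonneg _), ENNReal.ofReal_natCast]
  have hcmp := HMDP.lintegral_traj_le (M := M) (E := M.emission) γ z (P.llm t)
    ((D.expert z).comap Prod.snd measurable_snd) (fun k p => min 1 (D.posterior t k z p))
    (fun k => by fun_prop) (fun k p => min_le_left _ _) (M.H - 1)
    (fun k hk => posterior_joint_le hperf ht (by omega) (hac k (by omega)))
    (R := fun x => ENNReal.ofReal (M.totalReward (w t) x.2)) (by fun_prop) (B := M.H)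
    (fun x => by
      rw [← ENNReal.ofReal_natCast]
      exact ENNReal.ofReal_le_ofReal (M.totalReward_mem (w t) x.2).2)
  set XE := ∫⁻ x, ENNReal.ofReal (M.totalReward (w t) x.2)
    ∂(γ ⊗ₘ M.traj M.emission z (exploreCtx explore _) (M.H - 1)) with hXEdef
  set XL := ∫⁻ x, ENNReal.ofReal (M.totalReward (w t) x.2)
    ∂(γ ⊗ₘ M.traj M.emission z (P.llm t) (M.H - 1)) with hXLdef
  have hXEt : XE ≠ ∞ := ne_top_of_le_ne_top (ENNReal.natCast_ne_top _) hXE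
  have hXLt : XL ≠ ∞ := ne_top_of_le_ne_top (ENNReal.natCast_ne_top _) hXL
  set B : ℝ := M.H ^ 2 * ((Fintype.card Z - 1 : ℕ) * β) with hB
  have hB0 : 0 ≤ B := by positivity
  have hbound : ∫⁻ x, ENNReal.ofReal (M.totalReward (w t) x.2)
      ∂(γ ⊗ₘ M.traj M.emission z ((D.expert z).comap Prod.snd measurable_snd) (M.H - 1))
      ≤ XL + ENNReal.ofReal B := by
    refine hcmp.trans (add_le_add le_rfl ?_)
    calc _ ≤ (M.H : ℝ≥0∞) * ∑ j ∈ Finset.range (M.H - 1),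
          ENNReal.ofReal ((Fintype.card Z - 1 : ℕ) * β) := by
          gcongr with j hj
          exact hwrong j (by have := Finset.mem_range.1 hj; omega)
      _ ≤ (M.H : ℝ≥0∞) * ((M.H : ℝ≥0∞) * ENNReal.ofReal ((Fintype.card Z - 1 : ℕ) * β)) := by
          rw [Finset.sum_const, Finset.card_range, nsmul_eq_mul]
          gcongr
          omega
      _ = ENNReal.ofReal B := by
          rw [hB, pow_two, mul_assoc, ENNReal.ofReal_mul (p := (M.H : ℝ)) (Nat.cast_nonneg _),
            ENNReal.ofReal_mul (p := (M.H : ℝ)) (Nat.cast_nonneg _), ENNReal.ofReal_natCast]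
  have hVB : M.value z (D.expert z) (w t) ≤ XL.toReal + B := by
    rw [hVe]
    refine (ENNReal.toReal_mono (by finiteness) hbound).trans (le_of_eq ?_)
    rw [ENNReal.toReal_add hXLt (by finiteness), ENNReal.toReal_ofReal hB0]
  have hplan : (ENNReal.ofReal ε • XE + ENNReal.ofReal (1 - ε) • XL).toReal
      = ε * XE.toReal + (1 - ε) * XL.toReal := by
    rw [smul_eq_mul, smul_eq_mul, ENNReal.toReal_add (by finiteness) (by finiteness),
      ENNReal.toReal_mul, ENNReal.toReal_mul, ENNReal.toReal_ofReal h0,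
      ENNReal.toReal_ofReal (by linarith)]
  rw [hplan]
  -- With `V` the expert's value, the regret is at most `ε (V - XE) + (1 - ε) (V - XL) ≤ ε H + B`.
  nlinarith [ENNReal.toReal_nonneg (a := XE), ENNReal.toReal_nonneg (a := XL), mul_nonneg h0
    (ENNReal.toReal_nonneg (a := XE)), mul_nonneg h0 (sub_nonneg.2 hV), mul_nonneg
    (sub_nonneg.2 h1) (sub_nonneg.2 hVB), mul_nonneg h0 hB0]

end Deploy

end System

end PAR

end

/-! ### The truncated series and the prior -/

namespace PAR

lemma sum_mul_pow_le {ρ : ℝ} (h0 : 0 ≤ ρ) (h1 : ρ < 1) {a : ℝ} (ha : 0 ≤ a) (T : ℕ) :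
    ∑ t ∈ Finset.range T, a * ρ ^ t ≤ a / (1 - ρ) := by
  rw [← Finset.mul_sum, div_eq_mul_inv]
  have h := Summable.sum_le_tsum (Finset.range T) (fun i _ => pow_nonneg h0 i)
    (summable_geometric_of_lt_one h0 h1)
  rw [tsum_geometric_of_lt_one h0 h1] at h
  exact mul_le_mul_of_nonneg_left h ha

/-- A truncated geometric series is at most logarithmic in its leading coefficient. -/
lemma sum_min_one_le {ρ : ℝ} (h0 : 0 ≤ ρ) (h1 : ρ < 1) (T : ℕ) {a : ℝ} (ha : 1 ≤ a) :
    ∑ t ∈ Finset.range T, min 1 (a * ρ ^ t) ≤ (Real.log a + 2) / (1 - ρ) := by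
  have hx : 0 < 1 - ρ := by linarith
  induction T generalizing a with
  | zero => simpa using div_nonneg (by linarith [Real.log_nonneg ha]) hx.le
  | succ T ih =>
    rw [Finset.sum_range_succ', pow_zero, mul_one, min_eq_left ha]
    have hs : ∀ t, min 1 (a * ρ ^ (t + 1)) = min 1 (a * ρ * ρ ^ t) := fun t => by
      rw [pow_succ]; ring_nf
    simp only [hs]
    rw [le_div_iff₀ hx, add_mul]
    -- While `a ρ ≥ 1`, the peeled term costs `1 - ρ` after clearing the denominator, paid for by
    -- `log ρ ≤ ρ - 1`. Once `a ρ < 1`, the rest is a plain geometric series, and the constant `2`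
    -- covers it with the peeled term.
    rcases le_or_gt 1 (a * ρ) with h | h
    · have hρ : 0 < ρ := by
        rcases h0.eq_or_lt with rfl | h'
        · simp at h; linarith
        · exact h'
      have h2 := ih h
      rw [le_div_iff₀ hx, Real.log_mul (by linarith) hρ.ne'] at h2
      linarith [Real.log_le_sub_one_of_pos hρ]
    · have h2 : ∑ t ∈ Finset.range T, min 1 (a * ρ * ρ ^ t) ≤ a * ρ / (1 - ρ) :=
        (Finset.sum_le_sum fun t _ => min_le_right _ _).trans
          (sum_mul_pow_le h0 h1 (by positivity) T)
      rw [le_div_iff₀ hx] at h2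
      linarith [Real.log_nonneg ha]

lemma PriorRatioBounded.ne_zero {Z : Type*} {prior : PMF Z} {c : ℝ}
    (h : PriorRatioBounded prior c) (z : Z) : prior z ≠ 0 := by
  intro hz
  obtain ⟨z', hz'⟩ := prior.support_nonempty
  have h1 := h z z'
  rw [hz, ENNReal.toReal_zero, mul_zero] at h1
  exact (ENNReal.toReal_pos hz' (prior.apply_ne_top z')).not_ge h1

lemma PriorRatioBounded.one_le {Z : Type*} {prior : PMF Z} {c : ℝ}
    (h : PriorRatioBounded prior c) (z : Z) : 1 ≤ c := by
  have hp := ENNReal.toReal_pos (h.ne_zero z) (prior.apply_ne_top z)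
  have h1 := h z z
  by_contra hc
  push Not at hc
  nlinarith

lemma PriorRatioBounded.le_mul {Z : Type*} {prior : PMF Z} {c : ℝ}
    (h : PriorRatioBounded prior c) (z z' : Z) : prior z' ≤ ENNReal.ofReal c * prior z := by
  have hc := h.one_le z
  rw [← ENNReal.toReal_le_toReal (prior.apply_ne_top z')
    (ENNReal.mul_ne_top ENNReal.ofReal_ne_top (prior.apply_ne_top z)), ENNReal.toReal_mul,
    ENNReal.toReal_ofReal (by linarith)]
  exact h z z'

/-- Rewrites the target rate as `H T ε` for the uncapped `ε`, the quantity to which both parts of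
the regret are compared. -/
lemma rpow_mul_sqrt_eq {H T η L : ℝ} (hT : 0 < T) (hH : 0 < H) (hη : 0 < η) :
    H ^ (3 / 2 : ℝ) * √(T / η * L) = H * T * √(H * L / (T * η)) := by
  have h1 : H ^ (3 / 2 : ℝ) = H * √H := by
    rw [Real.sqrt_eq_rpow, show (3 / 2 : ℝ) = 1 + 1 / 2 by norm_num, Real.rpow_add hH,
      Real.rpow_one]
  have h2 : √H * √(T / η * L) = T * √(H * L / (T * η)) := by
    conv_rhs => rw [← Real.sqrt_sq hT.le, ← Real.sqrt_mul (by positivity)]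
    rw [← Real.sqrt_mul hH.le, Real.sqrt_sq hT.le]
    congr 1
    field_simp
  rw [h1, mul_assoc, h2, mul_assoc]

end PAR

/-! ### Summation over the episodes -/

theorem theorem4p3 :
    ∃ K : ℝ, 0 < K ∧
      ∀ {S A O G Ω Z : Type*} [MeasurableSpace S] [MeasurableSpace A] [MeasurableSpace O]
        [MeasurableSpace G] [MeasurableSpace Ω] [Fintype Z]
        (M : PAR.HMDP S A O G Ω Z) (D : PAR.Pretraining M) (P : PAR.System M)
        (explore : PAR.Policy PUnit O G) (c η : ℝ) (T : ℕ) (z : Z) (w : ℕ → Ω),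
        P.PerfectlyPretrained D →
        0 < c → PAR.PriorRatioBounded D.prior c →
        0 < η → PAR.Distinguishable M explore η →
        0 < T → T ≤ D.Tp →
        (∀ t < T, ∀ k < M.H,
          P.deployPromptLaw z explore (PAR.exploreProb M.H T (Fintype.card Z) c η) w t k
            ≪ D.promptLaw t k) →
        P.regret z (D.expert z) explore (PAR.exploreProb M.H T (Fintype.card Z) c η) w T
          ≤ K * (M.H : ℝ) ^ (3 / 2 : ℝ)
            * √((T : ℝ) / η * Real.log (c * Fintype.card Z * √(T : ℝ)))
            * (1 + Real.log T) := by
  -- One unit pays for exploration, five for the wrong posterior mass.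
  refine ⟨6, by norm_num, ?_⟩
  intro S A O G Ω Z _ _ _ _ _ _ M D P explore c η T z w hperf _ hprior hη hdist hT hTp hac
  have hE : P.reporter = M.emission := Kernel.ext hperf.reporter_eq
  have hc := hprior.one_le z
  have hn : 1 ≤ Fintype.card Z := Fintype.card_pos_iff.2 ⟨z⟩
  have hT1 : (1 : ℝ) ≤ T := by exact_mod_cast hT
  have hT0 : (0 : ℝ) < T := by linarith
  have hH : (1 : ℝ) ≤ M.H := by exact_mod_cast M.H_pos
  have hsT : 1 ≤ √(T : ℝ) := Real.one_le_sqrt.2 hT1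
  have hn1 : (1 : ℝ) ≤ Fintype.card Z := by exact_mod_cast hn
  set n : ℝ := (Fintype.card Z : ℝ) with hndef
  set L := Real.log (c * n * √(T : ℝ)) with hL
  have hcn : n ≤ c * n := le_mul_of_one_le_left (by linarith) hc
  have hcnT : c * n ≤ c * n * √(T : ℝ) := le_mul_of_one_le_right (by positivity) hsT
  have hL0 : 0 ≤ L := Real.log_nonneg (by linarith)
  set s := √((M.H : ℝ) * L / (T * η)) with hs
  have hs0 : 0 ≤ s := Real.sqrt_nonneg _
  have hssq : s ^ 2 = M.H * L / (T * η) := Real.sq_sqrt (by positivity)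
  have hrhs := PAR.rpow_mul_sqrt_eq (L := L) hT0 (by linarith : (0 : ℝ) < M.H) hη
  rw [← hs] at hrhs
  have hB0 : 0 ≤ M.H * T * s := by positivity
  -- The bound holds without the factor `1 + log T`, which is at least `1`.
  suffices h : P.regret z (D.expert z) explore (PAR.exploreProb M.H T (Fintype.card Z) c η) w T
      ≤ 6 * (M.H * T * s) by
    rw [mul_assoc 6, hrhs]
    refine h.trans (le_mul_of_one_le_right (by positivity) ?_)
    linarith [Real.log_nonneg hT1]
  have hε : PAR.exploreProb M.H T (Fintype.card Z) c η = min 1 s := rfl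
  rw [hε] at hac ⊢
  have hε0 : 0 ≤ min 1 s := le_min zero_le_one hs0
  have hε1 : min 1 s ≤ 1 := min_le_left _ _
  unfold PAR.System.regret
  have htriv : ∀ t, _ := fun t =>
    PAR.System.episode_regret_le_horizon (P := P) (z := z) (explore := explore) (w := w) (t := t)
      hε0 hε1 (D.expert z)
  -- If the cap is active, the trivial bound `H` per episode already suffices.
  rcases le_or_gt 1 s with h1s | hs1
  · refine (Finset.sum_le_sum fun t _ => htriv t).trans ?_
    rw [Finset.sum_const, Finset.card_range, nsmul_eq_mul]
    linarith [mul_le_mul_of_nonneg_left h1s (show (0 : ℝ) ≤ M.H * T by positivity)]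
  rw [min_eq_right hs1.le] at *
  have hllm : ∀ t < T, ∀ k < M.H, _ := fun t ht k hk =>
    PAR.System.llm_ac (D := D) hE hs0 hs1 (hac t ht k hk)
  -- A single latent variable leaves nothing to identify, so only exploration costs. The case is
  -- separate because `L`, and with it `s`, may vanish, and the main argument divides by `s`.
  rcases hn.eq_or_lt with hcard | hcard
  · have hsub : Subsingleton Z := Fintype.card_le_one_iff_subsingleton.1 hcard.ge
    have hreg : ∀ t ∈ Finset.range T, _ := fun t ht =>
      PAR.System.episode_regret_le hs0 hs1.le hperf ((Finset.mem_range.1 ht).trans_le hTp)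
        (hllm t (Finset.mem_range.1 ht)) le_rfl
        (fun k _ z' hz' => absurd (Subsingleton.elim z' z) hz')
    refine (Finset.sum_le_sum hreg).trans ?_
    rw [Finset.sum_const, Finset.card_range, nsmul_eq_mul]
    simp only [mul_zero, add_zero]
    linarith
  have hn2 : (2 : ℝ) ≤ n := by rw [hndef]; exact_mod_cast hcard
  -- With two latent variables `L ≥ log 2 > 1/2`. This absorbs the additive constant of the series:
  -- `log a + 2 ≤ L + 4 L = 5 L`.
  have hL2 : 1 / 2 ≤ L := by
    have h2 : Real.log 2 ≤ L := Real.log_le_log (by norm_num) (by linarith)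
    linarith [Real.log_two_gt_d9]
  have hspos : 0 < s := Real.sqrt_pos.2 (by positivity)
  have hη1 : η ≤ 1 := by
    obtain ⟨z', hz'⟩ := Fintype.exists_ne_of_one_lt_card hcard z
    exact (hdist z z' hz'.symm).trans (PAR.hellingerSq_le_one _ _)
  set ρ := 1 - s * η with hρ
  have hsη : s * η ≤ 1 := mul_le_one₀ hs1.le hη.le hη1
  have hsη0 : 0 < s * η := mul_pos hspos hη
  have hρ0 : 0 ≤ ρ := by linarith
  have hρ1 : ρ < 1 := by linarith
  set a := (Fintype.card Z - 1 : ℕ) * √c with ha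
  have hsub : ((Fintype.card Z - 1 : ℕ) : ℝ) = n - 1 := by
    rw [Nat.cast_sub hn]; simp [hndef]
  have hsc : 1 ≤ √c := Real.one_le_sqrt.2 hc
  have hscc : √c ≤ c := Real.sqrt_le_self_iff.2 (Or.inr hc)
  have ha1 : 1 ≤ a := by rw [ha, hsub]; exact one_le_mul_of_one_le_of_one_le (by linarith) hsc
  have haL : Real.log a ≤ L := by
    refine Real.log_le_log (by linarith) (le_trans ?_ hcnT)
    rw [ha, hsub, mul_comm]
    exact mul_le_mul hscc (by linarith) (by linarith) (by linarith)
  have hreg : ∀ t ∈ Finset.range T, ∫ c, (M.value z (D.expert z) (w t)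
      - M.expectedReturn (w t) (P.planner M.emission z explore s t (M.H - 1) (c, w t)))
      ∂(P.deployContextLaw z explore s w t) ≤ s * M.H + M.H ^ 2 * min 1 (a * ρ ^ t) := by
    intro t ht
    have htT := Finset.mem_range.1 ht
    rw [mul_min_of_nonneg _ _ (by positivity), ← min_add_add_left]
    refine le_min ?_ ?_
    · refine (htriv t).trans ?_
      have h1 : (M.H : ℝ) ≤ M.H ^ 2 := le_self_pow₀ hH two_ne_zero
      have h2 : 0 ≤ s * M.H := by positivity
      linarith
    · have hβ : ENNReal.ofReal (√c * ρ ^ t)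
          = ENNReal.ofReal c ^ (1 / 2 : ℝ) * ENNReal.ofReal ρ ^ t := by
        rw [ENNReal.ofReal_mul (by positivity), ENNReal.ofReal_pow hρ0,
          ← PAR.ofReal_sqrt_toReal ENNReal.ofReal_ne_top, ENNReal.toReal_ofReal (by linarith)]
      have := PAR.System.episode_regret_le hs0 hs1.le hperf (htT.trans_le hTp) (hllm t htT)
        (β := √c * ρ ^ t) (by positivity) fun k hk z' hz' => by
          rw [hβ]
          exact PAR.System.lintegral_posterior_le hE hspos hs1 hdist
            (fun i hi => hac i (by omega)) hz' (hprior.ne_zero z) (hprior.le_mul z z') hk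
      rw [ha, mul_assoc]
      exact this
  refine (Finset.sum_le_sum hreg).trans ?_
  rw [Finset.sum_add_distrib, Finset.sum_const, Finset.card_range, nsmul_eq_mul, ← Finset.mul_sum]
  have hsum := PAR.sum_min_one_le hρ0 hρ1 T ha1
  have hx : 1 - ρ = s * η := by rw [hρ]; ring
  rw [hx] at hsum
  have hsum2 : ∑ t ∈ Finset.range T, min 1 (a * ρ ^ t) ≤ 5 * (T * s / M.H) := by
    refine hsum.trans ((div_le_iff₀ (by positivity)).2 ?_)
    -- The defining equation `s² = H L / (T η)`, that is, the balance that dictates the choice of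
    -- `ε`.
    have h3 : (T : ℝ) * s / M.H * (s * η) = L := by
      rw [show (T : ℝ) * s / M.H * (s * η) = T * η / M.H * s ^ 2 by ring, hssq]
      field_simp
    rw [mul_assoc, h3]
    linarith
  have hfin : (M.H : ℝ) ^ 2 * (5 * (T * s / M.H)) = 5 * (M.H * T * s) := by
    field_simp
  have := mul_le_mul_of_nonneg_left hsum2 (show (0 : ℝ) ≤ (M.H : ℝ) ^ 2 by positivity)
  rw [hfin] at this
  linarith
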